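/- Let $\alpha,\beta,\gamma,\delta,\varepsilon,a,B\in\mathbb{C}$ with $\gamma+\delta+\varepsilon=1+\alpha+\beta$ and $a\neq 0,1$, and consider the Heun equation $$\frac{d^2y}{dx^2}+\Big(\frac{\gamma}{x}+\frac{\delta}{x-1}+\frac{\varepsilon}{x-a}\Big)\frac{dy}{dx}+\frac{\alpha\beta x-\frac{B}{4}}{x(x-1)(x-a)}\,y=0\qquad\text{on }\mathbb{P}^1\setminus\{0,1,a,\infty\}.$$ Let $\Lambda=2\omega_1\mathbb{Z}+2\omega_2\mathbb{Z}\subset\mathbb{C}$ be a lattice, $\omega_0=0$, $\omega_3=\omega_1+\omega_2$, let $\wp$ be its Weierstrass function and $e_i=\wp(\omega_i)$ for $i=1,2,3$, and suppose that $a=\frac{e_3-e_1}{e_2-e_1}$. Put $$m_0=\alpha-\beta-\tfrac12,\quad m_1=\tfrac12-\gamma,\quad m_2=\tfrac12-\delta,\quad m_3=\tfrac12-\varepsilon,$$ $$B'=(e_2-e_1)\Big(B-a\big((m_1+m_2)^2-m_3(m_3+1)\big)-\big((m_1+m_3)^2-m_2(m_2+1)\big)\Big)-m_0(m_0+1)e_1-\sum_{i=1}^3m_i(m_i+1)e_i,$$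 and consider the Darboux equation $$\frac{d^2u}{dz^2}-\Big(\sum_{i=0}^3m_i(m_i+1)\wp(z-\omega_i)\Big)u=B'u\qquad\text{on }(\mathbb{C}/\Lambda)\setminus\{\omega_0,\omega_1,\omega_2,\omega_3\}.$$ The substitution $x=\frac{\wp(z)-e_1}{e_2-e_1}$, $u=x^{-m_1/2}(x-1)^{-m_2/2}(x-a)^{-m_3/2}\,y$ (with any local branches of the powers) takes local solutions of the Heun equation to local solutions of this Darboux equation. Call a group $G\subset\mathrm{GL}(2,\mathbb{C})$ unitary if there is a non-degenerate, not necessarily definite, Hermitian matrix $H$ with $g^\dagger Hg=H$ for all $g\in G$; this does not depend on the base point and the basis of solutions that are used to define a monodromy group. If the monodromy group of the Heun equation is unitary and acts irreducibly on $\mathbb{C}^2$, then the monodromy group of the Darboux equation is unitary. -/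

import Mathlib

open Topology Filter
open scoped Matrix unitInterval

noncomputable section

namespace HeunDarboux

/-! ### Second-order linear equations, analytic continuation and monodromy -/

/-- `f` is a holomorphic solution of `f'' + p f' + q f = 0` in a neighbourhood of `z`. -/
def IsSolutionAt (p q f : ℂ → ℂ) (z : ℂ) : Prop :=
  AnalyticAt ℂ f z ∧ ∀ᶠ w in 𝓝 z, deriv (deriv f) w + p w * deriv f w + q w * f w = 0

/-- `y 0, y 1` are two linearly independent solutions of `f'' + p f' + q f = 0` near `z`
(linear independence is that of germs at `z`). -/
structure IsFundamentalAt (p q : ℂ → ℂ) (y : Fin 2 → ℂ → ℂ) (z : ℂ) : Prop where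
  sol : ∀ i, IsSolutionAt p q (y i) z
  indep : ∀ c : Fin 2 → ℂ, (∀ᶠ w in 𝓝 z, ∑ i, c i * y i w = 0) → c = 0

/-- `F` is an analytic continuation along the path `γ` by solutions of `f'' + p f' + q f = 0`:
each `F t` is a solution near `γ t`, and for `s` close to `t` the functions `F s` and `F t`
have the same germ at `γ s`. -/
structure IsContinuation (p q : ℂ → ℂ) {a b : ℂ} (γ : Path a b) (F : I → ℂ → ℂ) : Prop where
  sol : ∀ t, IsSolutionAt p q (F t) (γ t)
  compat : ∀ t, ∀ᶠ s in 𝓝 t, F s =ᶠ[𝓝 (γ s)] F t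

/-- Let `Ω ⊆ ℂ` be open, `Λ` a discrete group of translations that preserves `Ω`, and let `p, q`
be holomorphic and `Λ`-periodic on `Ω`, so that `f'' + p f' + q f = 0` is an equation on the
Riemann surface `Ω / Λ`. A closed loop of `Ω / Λ` based at the class of `z₀` is the image of a
path of `Ω` from `z₀` to some `z₀ + l`, `l ∈ Λ`. The matrix `M` is a monodromy matrix, with
respect to the solutions `y 0, y 1` near `z₀`, if for such a loop the analytic continuations
`ỹ 0, ỹ 1` of `y 0, y 1` along it satisfy `ỹ i = ∑ j, M i j * y j`. -/
def IsMonodromyMatrix (Ω : Set ℂ) (Λ : AddSubgroup ℂ) (p q : ℂ → ℂ) (z₀ : ℂ)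
    (y : Fin 2 → ℂ → ℂ) (M : GL (Fin 2) ℂ) : Prop :=
  ∃ l ∈ Λ, ∃ γ : Path z₀ (z₀ + l), (∀ t, γ t ∈ Ω) ∧
    ∃ F : Fin 2 → I → ℂ → ℂ,
      (∀ i, IsContinuation p q γ (F i)) ∧
      (∀ i, F i 0 =ᶠ[𝓝 z₀] y i) ∧
      (∀ i, ∀ᶠ w in 𝓝 z₀, F i 1 (w + l) = ∑ j, (M : Matrix (Fin 2) (Fin 2) ℂ) i j * y j w)

/-- The monodromy group of `f'' + p f' + q f = 0` on `Ω / Λ`, with base point `z₀` and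
basis of solutions `y`. -/
def monodromyGroup (Ω : Set ℂ) (Λ : AddSubgroup ℂ) (p q : ℂ → ℂ) (z₀ : ℂ)
    (y : Fin 2 → ℂ → ℂ) : Subgroup (GL (Fin 2) ℂ) :=
  Subgroup.closure {M | IsMonodromyMatrix Ω Λ p q z₀ y M}

/-! ### Matrix groups -/

/-- `G` is unitary: it preserves a non-degenerate (possibly indefinite) Hermitian form. -/
def IsUnitary (G : Subgroup (GL (Fin 2) ℂ)) : Prop :=
  ∃ H : Matrix (Fin 2) (Fin 2) ℂ, H.IsHermitian ∧ IsUnit H.det ∧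
    ∀ g ∈ G, (g : Matrix (Fin 2) (Fin 2) ℂ)ᴴ * H * (g : Matrix (Fin 2) (Fin 2) ℂ) = H

/-- The natural representation of a subgroup of `GL(2, ℂ)` on `ℂ²`. -/
def naturalRep (G : Subgroup (GL (Fin 2) ℂ)) : Representation ℂ G (Fin 2 → ℂ) where
  toFun g := Matrix.mulVecLin ((g : GL (Fin 2) ℂ) : Matrix (Fin 2) (Fin 2) ℂ)
  map_one' := by rw [Subgroup.coe_one, Units.val_one, Matrix.mulVecLin_one]; rfl
  map_mul' g h := by
    rw [Subgroup.coe_mul, Units.val_mul, Matrix.mulVecLin_mul]; rfl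

/-! ### The Heun equation -/

/-- The coefficient of `y'` in the Heun equation. -/
def heunP (γ δ ε a : ℂ) (x : ℂ) : ℂ := γ / x + δ / (x - 1) + ε / (x - a)

/-- The coefficient of `y` in the Heun equation. -/
def heunQ (α β a B : ℂ) (x : ℂ) : ℂ := (α * β * x - B / 4) / (x * (x - 1) * (x - a))

/-- The monodromy group of the Heun equation on `ℂ ∖ {0, 1, a} = ℙ¹ ∖ {0, 1, a, ∞}`. -/
def heunGroup (α β γ δ ε a B x₀ : ℂ) (y : Fin 2 → ℂ → ℂ) : Subgroup (GL (Fin 2) ℂ) :=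
  monodromyGroup {x | x ≠ 0 ∧ x ≠ 1 ∧ x ≠ a} ⊥ (heunP γ δ ε a) (heunQ α β a B) x₀ y

/-! ### The Darboux equation -/

/-- The points `ω₀ = 0` and `ω₁, ω₂, ω₃ = ω₁ + ω₂`; the periods of the lattice are
`L.ω₁ = 2 ω₁` and `L.ω₂ = 2 ω₂`. -/
def halfPeriod (L : PeriodPair) : Fin 4 → ℂ :=
  ![0, L.ω₁ / 2, L.ω₂ / 2, L.ω₁ / 2 + L.ω₂ / 2]

/-- The values `e i = ℘(ω i)`, used for `i = 1, 2, 3`. -/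
def halfValue (L : PeriodPair) (i : Fin 4) : ℂ := L.weierstrassP (halfPeriod L i)

/-- The coefficient of `u` in the Darboux equation
`u'' - (∑ m i (m i + 1) ℘(z - ω i)) u = B' u`, all terms being on the left-hand side. -/
def darbouxQ (L : PeriodPair) (m : Fin 4 → ℂ) (B' : ℂ) (z : ℂ) : ℂ :=
  -(∑ i, m i * (m i + 1) * L.weierstrassP (z - halfPeriod L i)) - B'

/-- The complex plane without the points `ω i + Λ`, which are those `z` with `2 z ∈ Λ`. -/
def darbouxDomain (L : PeriodPair) : Set ℂ := {z | 2 * z ∉ L.lattice}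

/-- The monodromy group of the Darboux equation on the torus `ℂ / Λ` without the four
points `ω i`. -/
def darbouxGroup (L : PeriodPair) (m : Fin 4 → ℂ) (B' z₀ : ℂ) (u : Fin 2 → ℂ → ℂ) :
    Subgroup (GL (Fin 2) ℂ) :=
  monodromyGroup (darbouxDomain L) L.lattice.toAddSubgroup 0 (darbouxQ L m B') z₀ u

/-! ### From Heun to Darboux -/

/-- The parameters `m₀ = α - β - 1/2`, `m₁ = 1/2 - γ`, `m₂ = 1/2 - δ`, `m₃ = 1/2 - ε`. -/
def darbouxParam (α β γ δ ε : ℂ) : Fin 4 → ℂ :=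
  ![α - β - 1 / 2, 1 / 2 - γ, 1 / 2 - δ, 1 / 2 - ε]

/-- The change of variable `x = (℘(z) - e₁) / (e₂ - e₁)`. -/
def heunVar (L : PeriodPair) (z : ℂ) : ℂ :=
  (L.weierstrassP z - halfValue L 1) / (halfValue L 2 - halfValue L 1)

/-- The accessory parameter `B' = (e₂ - e₁) B + B₀` of the Darboux equation obtained from the
Heun equation, for Darboux parameters `m` and `a = (e₃ - e₁) / (e₂ - e₁)`. -/
def darbouxB (L : PeriodPair) (m : Fin 4 → ℂ) (a B : ℂ) : ℂ :=
  (halfValue L 2 - halfValue L 1) *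
      (B - a * ((m 1 + m 2) ^ 2 - m 3 * (m 3 + 1)) - ((m 1 + m 3) ^ 2 - m 2 * (m 2 + 1)))
    - m 0 * (m 0 + 1) * halfValue L 1
    - (m 1 * (m 1 + 1) * halfValue L 1 + m 2 * (m 2 + 1) * halfValue L 2
      + m 3 * (m 3 + 1) * halfValue L 3)

/-- `g` is a branch, near `z₀`, of the factor
`x ^ (-m₁/2) * (x - 1) ^ (-m₂/2) * (x - a) ^ (-m₃/2)`, `x = heunVar L z`: the three powers are
formed with holomorphic logarithms `ℓ 0, ℓ 1, ℓ 2` of `x, x - 1, x - a` near `z₀`. -/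
def IsFactorBranch (L : PeriodPair) (m : Fin 4 → ℂ) (a : ℂ) (z₀ : ℂ) (g : ℂ → ℂ) : Prop :=
  ∃ ℓ : Fin 3 → ℂ → ℂ, (∀ i, AnalyticAt ℂ (ℓ i) z₀) ∧
    ∀ᶠ z in 𝓝 z₀,
      Complex.exp (ℓ 0 z) = heunVar L z ∧
      Complex.exp (ℓ 1 z) = heunVar L z - 1 ∧
      Complex.exp (ℓ 2 z) = heunVar L z - a ∧
      g z = Complex.exp (-m 1 / 2 * ℓ 0 z) * Complex.exp (-m 2 / 2 * ℓ 1 z)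
        * Complex.exp (-m 3 / 2 * ℓ 2 z)

end HeunDarboux

end

namespace HeunDarboux

/-! Up to a scalar factor, Darboux solutions are Heun solutions pulled back along the
lattice-periodic map x = `heunVar L z`. A loop on the punctured torus therefore maps to a loop in ℂ
∖ {0, 1, a}. Continuing g · y(x) around it applies a Heun monodromy matrix N to y and multiplies g
by a constant c. With A the fixed matrix that expresses the pulled-back basis by the Darboux basis,
each Darboux monodromy matrix M satisfies A M = c N A (`exists_heun_loop`). The Darboux equation has
no first-order term, so the Wronskian is constant and det M = 1 (`IsMonodromyMatrix.det_eq_one`).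
Hence c² det N = 1. If N preserves a non-degenerate Hermitian H, then |det N| = 1, so |c| = 1; the
scalar is invisible to Hermitian forms and M preserves Aᴴ H A (`preserves_of_conj_smul`).

That the pullback solves the Darboux equation is the computation `isSolutionAt_darboux`. It rests on
the cubic equation for ℘' and on the translation of ℘ by half periods, a Liouville argument in
`exists_weierstrassP_mul_translate_eq`. The factor g is treated as a solution of g' = k g, which
makes its continuation independent of any choice of logarithms.

The analytic input is local existence on a neighbourhood common to all germs
(`exists_nhds_solution_extends`), continuation along paths (`exists_continues`) and its uniqueness
(`Continues.eventuallyEq`). -/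

/-! ### Continuation along paths -/

/-- `F` is a continuation along `γ` in the local system whose germs at `z` are the `f` with
`S z f`. -/
structure Continues (S : ℂ → (ℂ → ℂ) → Prop) {a b : ℂ} (γ : Path a b) (F : I → ℂ → ℂ) : Prop where
  sol : ∀ t, S (γ t) (F t)
  compat : ∀ t, ∀ᶠ s in 𝓝 t, F s =ᶠ[𝓝 (γ s)] F t

theorem isContinuation_iff {p q : ℂ → ℂ} {a b : ℂ} {γ : Path a b} {F : I → ℂ → ℂ} :
    IsContinuation p q γ F ↔ Continues (fun z f => IsSolutionAt p q f z) γ F :=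
  ⟨fun h => ⟨h.sol, h.compat⟩, fun h => ⟨h.sol, h.compat⟩⟩

theorem eventually_path_eventuallyEq {a b : ℂ} (γ : Path a b) {f g : ℂ → ℂ} {t : I}
    (h : f =ᶠ[𝓝 (γ t)] g) : ∀ᶠ s in 𝓝 t, f =ᶠ[𝓝 (γ s)] g :=
  γ.continuous.continuousAt.eventually h.eventually_nhds

/-- Germs of a local system can be continued along every path on which the system is locally
constant. -/
theorem exists_continues {S : ℂ → (ℂ → ℂ) → Prop} {a b : ℂ} (γ : Path a b)
    (hloc : ∀ t, ∃ U ∈ 𝓝 (γ t), ∀ w ∈ U, ∀ f, S w f → ∃ f', (∀ z ∈ U, S z f') ∧ f' =ᶠ[𝓝 w] f)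
    {f : ℂ → ℂ} (hf : S a f) : ∃ F, Continues S γ F ∧ F 0 = f := by
  choose U hU hext using hloc
  obtain ⟨t, ht0, hmono, ⟨N, hN⟩, hcov⟩ := exists_monotone_Icc_subset_open_cover_unitInterval
    (c := fun s : I => γ ⁻¹' interior (U s)) (fun s => isOpen_interior.preimage γ.continuous)
    (fun s _ => Set.mem_iUnion.2 ⟨s, mem_interior_iff_mem_nhds.2 (hU s)⟩)
  -- The continuation is extended over one interval of the subdivision at a time. Compatibility is
  -- only required for r ≤ `t n`, since F carries no information beyond that point yet.
  have key : ∀ n, ∃ F : I → ℂ → ℂ, F 0 = f ∧ (∀ s ≤ t n, S (γ s) (F s)) ∧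
      ∀ s ≤ t n, ∀ᶠ r in 𝓝 s, r ≤ t n → F r =ᶠ[𝓝 (γ r)] F s := by
    intro n
    induction n with
    | zero =>
      refine ⟨fun _ => f, rfl, fun s hs => ?_, fun s _ => .of_forall fun r _ => .rfl⟩
      have : s = 0 := le_antisymm (ht0 ▸ hs) bot_le
      simpa [this] using hf
    | succ n ih =>
      obtain ⟨F, hF0, hFs, hFc⟩ := ih
      obtain ⟨i, hi⟩ := hcov n
      obtain ⟨f', hf'S, hf'⟩ := hext i (γ (t n))
        (interior_subset (hi ⟨le_rfl, hmono n.le_succ⟩)) (F (t n)) (hFs _ le_rfl)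
      refine ⟨fun s => if s ≤ t n then F s else f', ?_, fun s hs => ?_, fun s hs => ?_⟩
      · exact (if_pos (show (0 : I) ≤ t n from bot_le)).trans hF0
      · dsimp only
        split_ifs with h
        · exact hFs s h
        · exact hf'S _ (interior_subset (hi ⟨(not_le.1 h).le, hs⟩))
      · rcases lt_trichotomy s (t n) with h | h | h
        · filter_upwards [hFc s h.le, eventually_lt_nhds h] with r hr hrt _
          rw [if_pos hrt.le, if_pos h.le]
          exact hr hrt.le
        · have h1 := eventually_path_eventuallyEq γ hf'
          rw [← h] at h1
          filter_upwards [hFc s h.le, h1] with r hr hr1 _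
          rw [if_pos h.le]
          split_ifs with h2
          · exact hr h2
          · exact hr1
        · filter_upwards [eventually_gt_nhds h] with r hr _
          rw [if_neg (not_le.2 hr), if_neg (not_le.2 h)]
  obtain ⟨F, h0, hs, hc⟩ := key N
  have h1 : ∀ s : I, s ≤ t N := fun s => by rw [hN N le_rfl]; exact le_top
  exact ⟨F, ⟨fun s => hs s (h1 s), fun s => (hc s (h1 s)).mono fun r hr => hr (h1 r)⟩, h0⟩

/-- The principle of analytic continuation along a path. -/
theorem Continues.eventuallyEq {S S' : ℂ → (ℂ → ℂ) → Prop} {a b : ℂ} {γ : Path a b}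
    {F F' : I → ℂ → ℂ} (hF : Continues S γ F) (hF' : Continues S' γ F')
    (hS : ∀ z f, S z f → AnalyticAt ℂ f z) (hS' : ∀ z f, S' z f → AnalyticAt ℂ f z) {t₀ : I}
    (h : F t₀ =ᶠ[𝓝 (γ t₀)] F' t₀) (t : I) : F t =ᶠ[𝓝 (γ t)] F' t := by
  let A : Set I := {t | F t =ᶠ[𝓝 (γ t)] F' t}
  have hopen : IsOpen A := by
    refine isOpen_iff_mem_nhds.2 fun s hs => ?_
    filter_upwards [hF.compat s, hF'.compat s, eventually_path_eventuallyEq γ hs] with r h1 h2 h3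
    exact (h1.trans h3).trans h2.symm
  -- At a limit point s both germs are analytic on a common disk, which contains a point γ x where
  -- they agree; the identity theorem spreads the agreement over the disk.
  have hclosed : IsClosed A := by
    refine isClosed_of_closure_subset fun s hs => ?_
    obtain ⟨r, hr, hB⟩ := (Metric.eventually_nhds_iff_ball.1
      ((hS _ _ (hF.sol s)).eventually_analyticAt.and (hS' _ _ (hF'.sol s)).eventually_analyticAt))
    have h1 : ∀ᶠ x in 𝓝 s, γ x ∈ Metric.ball (γ s) r :=
      γ.continuous.continuousAt.eventually (Metric.ball_mem_nhds _ hr)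
    obtain ⟨x, ⟨⟨hx1, hx2⟩, hx3⟩, hx4⟩ := (((mem_closure_iff_frequently.1 hs).and_eventually
      ((hF.compat s).and ((hF'.compat s).and h1))).mono fun x hx =>
        (⟨⟨⟨hx.2.1, hx.2.2.1⟩, hx.2.2.2⟩, hx.1⟩ : ((_ ∧ _) ∧ _) ∧ _)).exists
    have h2 : F s =ᶠ[𝓝 (γ x)] F' s := (hx1.symm.trans hx4).trans hx2
    have h3 := AnalyticOnNhd.eqOn_of_preconnected_of_eventuallyEq
      (fun z hz => (hB z hz).1) (fun z hz => (hB z hz).2)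
      (convex_ball (γ s) r).isPreconnected hx3 h2
    exact eventually_of_mem (Metric.ball_mem_nhds _ hr) h3
  have : A = Set.univ := IsClopen.eq_univ ⟨hclosed, hopen⟩ ⟨t₀, h⟩
  exact (this ▸ Set.mem_univ t : t ∈ A)

theorem Continues.symm {S : ℂ → (ℂ → ℂ) → Prop} {a b : ℂ} {γ : Path a b} {F : I → ℂ → ℂ}
    (hF : Continues S γ F) : Continues S γ.symm (fun t => F (σ t)) :=
  ⟨fun t => hF.sol (σ t), fun t =>
    unitInterval.continuous_symm.continuousAt.eventually (hF.compat (σ t))⟩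

theorem Continues.trans {S : ℂ → (ℂ → ℂ) → Prop} {a b c : ℂ} {γ : Path a b} {γ' : Path b c}
    {F F' : I → ℂ → ℂ} (hF : Continues S γ F) (hF' : Continues S γ' F')
    (h : F 1 =ᶠ[𝓝 b] F' 0) :
    ∃ K, Continues S (γ.trans γ') K ∧ K 0 = F 0 ∧ K 1 = F' 1 := by
  -- The rescaled parameters of the two halves are clamped to [0, 1], so u and v are continuous on
  -- all of I and equal 1 and 0 at the midpoint.
  let u : I → I := fun t => Set.projIcc 0 1 zero_le_one (2 * (t : ℝ))
  let v : I → I := fun t => Set.projIcc 0 1 zero_le_one (2 * (t : ℝ) - 1)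
  have hu : Continuous u := continuous_projIcc.comp (by fun_prop)
  have hv : Continuous v := continuous_projIcc.comp (by fun_prop)
  have hγ : ∀ t : I, (t : ℝ) ≤ 1 / 2 → γ.trans γ' t = γ (u t) := fun t ht => by
    rw [Path.trans_apply, dif_pos ht]
    congr 1
    exact (Set.projIcc_of_mem zero_le_one _).symm
  have hγ' : ∀ t : I, (1 : ℝ) / 2 ≤ t → γ.trans γ' t = γ' (v t) := fun t ht => by
    rcases ht.lt_or_eq with h1 | h1
    · rw [Path.trans_apply, dif_neg (not_le.2 h1)]
      congr 1
      exact (Set.projIcc_of_mem zero_le_one _).symm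
    · have e1 : u t = 1 := by simp [u, ← h1]
      have e2 : v t = 0 := by simp [v, ← h1]
      rw [hγ t h1.ge, e1, e2, γ.target, γ'.source]
  have coe_ev : ∀ t : I, Tendsto (fun s : I => (s : ℝ)) (𝓝 t) (𝓝 (t : ℝ)) := fun t =>
    continuous_subtype_val.continuousAt
  refine ⟨fun t => if (t : ℝ) ≤ 1 / 2 then F (u t) else F' (v t), ⟨fun t => ?_, fun t => ?_⟩,
    ?_, ?_⟩
  · split_ifs with h1
    · rw [hγ t h1]; exact hF.sol _
    · rw [hγ' t (not_le.1 h1).le]; exact hF'.sol _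
  · have c1 := hu.continuousAt.eventually (hF.compat (u t))
    have c2 := hv.continuousAt.eventually (hF'.compat (v t))
    rcases lt_trichotomy (t : ℝ) (1 / 2) with h1 | h1 | h1
    · filter_upwards [c1, (coe_ev t).eventually (eventually_lt_nhds h1)] with s hs hs1
      rw [if_pos hs1.le, if_pos h1.le, hγ s hs1.le]
      exact hs
    · have e1 : u t = 1 := by simp [u, h1]
      have e2 : v t = 0 := by simp [v, h1]
      have h3 : F 1 =ᶠ[𝓝 (γ' (v t))] F' 0 := by rw [e2, γ'.source]; exact h
      filter_upwards [c1, c2, hv.continuousAt.eventually (eventually_path_eventuallyEq γ' h3)]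
        with s hs hs' hs''
      rw [if_pos h1.le, e1]
      split_ifs with h2
      · rw [hγ s h2]
        rw [e1] at hs
        exact hs
      · rw [hγ' s (not_le.1 h2).le]
        rw [e2] at hs'
        exact hs'.trans hs''.symm
    · filter_upwards [c2, (coe_ev t).eventually (eventually_gt_nhds h1)] with s hs hs1
      rw [if_neg (not_le.2 hs1), if_neg (not_le.2 h1), hγ' s hs1.le]
      exact hs
  · have : u 0 = 0 := by simp [u]
    simp [this]
  · have : v 1 = 1 := by
      simp only [v]
      norm_num
    have h2 : ¬ ((1 : I) : ℝ) ≤ 1 / 2 := by norm_num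
    simp only [if_neg h2, this]

/-! ### Linear equations of the second order -/

section Germs

variable {p q : ℂ → ℂ} {z : ℂ}

theorem IsSolutionAt.eventually {f : ℂ → ℂ} (hf : IsSolutionAt p q f z) :
    ∀ᶠ w in 𝓝 z, IsSolutionAt p q f w := by
  filter_upwards [hf.1.eventually_analyticAt, hf.2.eventually_nhds] with w h1 h2
  exact ⟨h1, h2⟩

theorem deriv_lin {f g : ℂ → ℂ} (hf : AnalyticAt ℂ f z) (hg : AnalyticAt ℂ g z) (a b : ℂ) :
    deriv (fun w => a * f w + b * g w) z = a * deriv f z + b * deriv g z :=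
  ((hf.differentiableAt.hasDerivAt.const_mul a).add
    (hg.differentiableAt.hasDerivAt.const_mul b)).deriv

theorem IsSolutionAt.lin {f g : ℂ → ℂ} (hf : IsSolutionAt p q f z) (hg : IsSolutionAt p q g z)
    (a b : ℂ) : IsSolutionAt p q (fun w => a * f w + b * g w) z := by
  have h1 : ∀ᶠ w in 𝓝 z, deriv (fun w => a * f w + b * g w) w = a * deriv f w + b * deriv g w := by
    filter_upwards [hf.1.eventually_analyticAt, hg.1.eventually_analyticAt] with w h1 h2
    exact deriv_lin h1 h2 a b
  have h2 : ∀ᶠ w in 𝓝 z, deriv (deriv (fun w => a * f w + b * g w)) w =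
      a * deriv (deriv f) w + b * deriv (deriv g) w := by
    filter_upwards [EventuallyEq.deriv h1, hf.1.eventually_analyticAt,
      hg.1.eventually_analyticAt] with w h1 h2 h3
    rw [h1, deriv_lin h2.deriv h3.deriv]
  refine ⟨(analyticAt_const.mul hf.1).add (analyticAt_const.mul hg.1), ?_⟩
  filter_upwards [h1, h2, hf.2, hg.2] with w h1 h2 h3 h4
  rw [h1, h2]
  linear_combination a * h3 + b * h4

theorem IsSolutionAt.sum {f : Fin 2 → ℂ → ℂ} (hf : ∀ i, IsSolutionAt p q (f i) z)
    (c : Fin 2 → ℂ) : IsSolutionAt p q (fun w => ∑ i, c i * f i w) z := by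
  simpa only [Fin.sum_univ_two] using (hf 0).lin (hf 1) (c 0) (c 1)

theorem deriv_sum {f : Fin 2 → ℂ → ℂ} (hf : ∀ i, AnalyticAt ℂ (f i) z) (c : Fin 2 → ℂ) :
    deriv (fun w => ∑ i, c i * f i w) z = ∑ i, c i * deriv (f i) z := by
  simpa only [Fin.sum_univ_two] using deriv_lin (hf 0) (hf 1) (c 0) (c 1)

/-- A solution with vanishing Cauchy data vanishes. -/
theorem IsSolutionAt.eventuallyEq_zero {f : ℂ → ℂ} (hp : AnalyticAt ℂ p z)
    (hq : AnalyticAt ℂ q z) (hf : IsSolutionAt p q f z) (h0 : f z = 0) (h1 : deriv f z = 0) :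
    ∀ᶠ w in 𝓝 z, f w = 0 := by
  -- Compare orders of vanishing. As f and f' vanish at z, each derivative lowers the order by one,
  -- whereas f'' = -(p f' + q f) vanishes at least to the order of f'. Only infinite order is
  -- possible.
  have e1 := hf.1.analyticOrderAt_deriv_add_one
  have e2 := hf.1.deriv.analyticOrderAt_deriv_add_one
  simp only [h0, h1, sub_zero] at e1 e2
  rw [← analyticOrderAt_eq_top]
  by_contra hne
  have e3 : analyticOrderAt (deriv (deriv f)) z =
      analyticOrderAt (-(p * deriv f + q * f)) z := by
    refine analyticOrderAt_congr ?_
    filter_upwards [hf.2] with w hw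
    simp only [Pi.neg_apply, Pi.add_apply, Pi.mul_apply]
    linear_combination hw
  rw [analyticOrderAt_neg] at e3
  have e4 : min (analyticOrderAt (p * deriv f) z) (analyticOrderAt (q * f) z) ≤
      analyticOrderAt (deriv (deriv f)) z := e3 ▸ le_analyticOrderAt_add
  rw [analyticOrderAt_mul hp hf.1.deriv, analyticOrderAt_mul hq hf.1] at e4
  have e5 : analyticOrderAt (deriv f) z ≤ analyticOrderAt f z := e1 ▸ le_self_add
  have e6 : analyticOrderAt (deriv f) z ≤ analyticOrderAt (deriv (deriv f)) z :=
    (le_min (le_add_self) (e5.trans le_add_self)).trans e4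
  have e7 : analyticOrderAt (deriv (deriv f)) z ≠ ⊤ := by
    intro h
    rw [h, top_add] at e2
    rw [← e2, top_add] at e1
    exact hne e1.symm
  rw [← e2, ENat.add_one_le_iff e7] at e6
  exact lt_irrefl _ e6

/-- The Wronskian of two functions. -/
noncomputable def wronskian (y : Fin 2 → ℂ → ℂ) (z : ℂ) : ℂ :=
  y 0 z * deriv (y 1) z - y 1 z * deriv (y 0) z

theorem IsFundamentalAt.wronskian_ne_zero {y : Fin 2 → ℂ → ℂ} (hp : AnalyticAt ℂ p z)
    (hq : AnalyticAt ℂ q z) (hy : IsFundamentalAt p q y z) : wronskian y z ≠ 0 := by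
  intro hW
  -- A kernel vector of the Wronskian matrix is a combination with zero Cauchy data at z.
  let N : Matrix (Fin 2) (Fin 2) ℂ := !![y 0 z, y 1 z; deriv (y 0) z, deriv (y 1) z]
  have hdet : N.det = 0 := by
    rw [Matrix.det_fin_two_of]; unfold wronskian at hW; linear_combination hW
  obtain ⟨c, hc0, hc⟩ := Matrix.exists_mulVec_eq_zero_iff.2 hdet
  have h1 := congrFun hc 0
  have h2 := congrFun hc 1
  simp only [N, Matrix.mulVec, dotProduct, Fin.sum_univ_two, Matrix.of_apply, Matrix.cons_val',
    Matrix.cons_val_zero, Matrix.cons_val_one, Matrix.cons_val_fin_one, Pi.zero_apply] at h1 h2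
  refine hc0 (hy.indep c ?_)
  refine (IsSolutionAt.sum hy.sol c).eventuallyEq_zero hp hq ?_ ?_
  · rw [Fin.sum_univ_two]; linear_combination h1
  · rw [deriv_sum fun i => (hy.sol i).1, Fin.sum_univ_two]; linear_combination h2

/-- Every solution is a combination of a fundamental system. -/
theorem IsFundamentalAt.exists_coeff {y : Fin 2 → ℂ → ℂ} (hp : AnalyticAt ℂ p z)
    (hq : AnalyticAt ℂ q z) (hy : IsFundamentalAt p q y z) {f : ℂ → ℂ}
    (hf : IsSolutionAt p q f z) : ∃ c : Fin 2 → ℂ, ∀ᶠ w in 𝓝 z, f w = ∑ i, c i * y i w := by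
  have hW := hy.wronskian_ne_zero hp hq
  set W := wronskian y z with hWdef
  -- Cramer's rule: these coefficients give the combination with the Cauchy data of f at z.
  let c : Fin 2 → ℂ := ![(f z * deriv (y 1) z - y 1 z * deriv f z) / W,
    (y 0 z * deriv f z - f z * deriv (y 0) z) / W]
  have hs := IsSolutionAt.sum hy.sol c
  have h0 := (hf.lin hs 1 (-1)).eventuallyEq_zero hp hq ?_ ?_
  · exact ⟨c, h0.mono fun w hw => by linear_combination hw⟩
  · simp only [Fin.sum_univ_two, c, Matrix.cons_val_zero, Matrix.cons_val_one]
    field_simp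
    rw [hWdef, wronskian]
    ring
  · rw [deriv_lin hf.1 hs.1, deriv_sum fun i => (hy.sol i).1]
    simp only [Fin.sum_univ_two, c, Matrix.cons_val_zero, Matrix.cons_val_one]
    field_simp
    rw [hWdef, wronskian]
    ring

theorem IsFundamentalAt.exists_matrix {y v : Fin 2 → ℂ → ℂ} (hp : AnalyticAt ℂ p z)
    (hq : AnalyticAt ℂ q z) (hy : IsFundamentalAt p q y z) (hv : ∀ i, IsSolutionAt p q (v i) z) :
    ∃ A : Matrix (Fin 2) (Fin 2) ℂ, ∀ i, ∀ᶠ w in 𝓝 z, v i w = ∑ j, A i j * y j w := by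
  choose A hA using fun i => hy.exists_coeff hp hq (hv i)
  exact ⟨A, hA⟩

theorem IsFundamentalAt.matrix_ext {y : Fin 2 → ℂ → ℂ} (hy : IsFundamentalAt p q y z)
    {A B : Matrix (Fin 2) (Fin 2) ℂ}
    (h : ∀ i, ∀ᶠ w in 𝓝 z, ∑ j, A i j * y j w = ∑ j, B i j * y j w) : A = B := by
  ext i j
  have := hy.indep (fun j => A i j - B i j) ((h i).mono fun w hw => by
    simp only [Fin.sum_univ_two] at hw ⊢
    linear_combination hw)
  exact sub_eq_zero.1 (congrFun this j)

/-- The matrix expressing a fundamental system by another one is invertible. -/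
theorem IsFundamentalAt.isUnit_det {y v : Fin 2 → ℂ → ℂ} (hv : IsFundamentalAt p q v z)
    {A : Matrix (Fin 2) (Fin 2) ℂ} (hA : ∀ i, ∀ᶠ w in 𝓝 z, v i w = ∑ j, A i j * y j w) :
    A.det ≠ 0 := by
  intro hdet
  obtain ⟨c, hc0, hc⟩ := Matrix.exists_vecMul_eq_zero_iff.2 hdet
  refine hc0 (hv.indep c ?_)
  have h1 := congrFun hc 0
  have h2 := congrFun hc 1
  simp only [Matrix.vecMul, dotProduct, Fin.sum_univ_two, Pi.zero_apply] at h1 h2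
  filter_upwards [hA 0, hA 1] with w e0 e1
  simp only [Fin.sum_univ_two] at e0 e1 ⊢
  rw [e0, e1]
  linear_combination y 0 w * h1 + y 1 w * h2

theorem wronskian_comb {y v : Fin 2 → ℂ → ℂ} (hy : ∀ i, AnalyticAt ℂ (y i) z)
    {M : Matrix (Fin 2) (Fin 2) ℂ} (hM : ∀ i, ∀ᶠ w in 𝓝 z, v i w = ∑ j, M i j * y j w) :
    wronskian v z = M.det * wronskian y z := by
  have hd : ∀ i, deriv (v i) z = ∑ j, M i j * deriv (y j) z := fun i => by
    rw [EventuallyEq.deriv_eq (hM i), deriv_sum hy]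
  rw [wronskian, hd, hd, (hM 0).self_of_nhds, (hM 1).self_of_nhds, Matrix.det_fin_two, wronskian]
  simp only [Fin.sum_univ_two]
  ring

end Germs

/-! ### Existence of solutions -/

section Existence

open Metric

variable {p q : ℂ → ℂ} {c : ℂ} {r K : ℝ}

/-- One step of the iteration that solves the equation. -/
theorem exists_double_primitive (hr : 0 < r) (hr1 : r ≤ 1)
    (hp : DifferentiableOn ℂ p (ball c r)) (hq : DifferentiableOn ℂ q (ball c r))
    (hpK : ∀ z ∈ ball c r, ‖p z‖ ≤ K) (hqK : ∀ z ∈ ball c r, ‖q z‖ ≤ K) (hK : 4 * K * r ≤ 1)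
    {f f₁ : ℂ → ℂ} {M : ℝ} (hf : DifferentiableOn ℂ f (ball c r))
    (hf₁ : DifferentiableOn ℂ f₁ (ball c r)) (hfM : ∀ z ∈ ball c r, ‖f z‖ ≤ M)
    (hf₁M : ∀ z ∈ ball c r, ‖f₁ z‖ ≤ M) :
    ∃ h h₁ : ℂ → ℂ, (∀ z ∈ ball c r, HasDerivAt h (h₁ z) z) ∧
      (∀ z ∈ ball c r, HasDerivAt h₁ (-(p z * f₁ z + q z * f z)) z) ∧ h c = 0 ∧ h₁ c = 0 ∧
      (∀ z ∈ ball c r, ‖h z‖ ≤ M / 2) ∧ ∀ z ∈ ball c r, ‖h₁ z‖ ≤ M / 2 := by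
  have hc : c ∈ ball c r := mem_ball_self hr
  have hM : 0 ≤ M := (norm_nonneg _).trans (hfM c hc)
  have hK0 : 0 ≤ K := (norm_nonneg _).trans (hpK c hc)
  obtain ⟨h₁, h₁c, hh₁⟩ := (((hp.mul hf₁).add (hq.mul hf)).neg.isExactOn_ball).with_val_at c 0
  have hh₁d : DifferentiableOn ℂ h₁ (ball c r) := fun z hz =>
    (hh₁ z hz).differentiableAt.differentiableWithinAt
  obtain ⟨h, hc0, hh⟩ := hh₁d.isExactOn_ball.with_val_at c 0
  have hz' : ∀ z ∈ ball c r, ‖z - c‖ ≤ r := fun z hz => (mem_ball_iff_norm.1 hz).le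
  -- By the mean value inequality the new derivative is at most 2 K M r, and 4 K r ≤ 1 turns this
  -- into M / 2. Integrating once more loses nothing because r ≤ 1.
  have b1 : ∀ z ∈ ball c r, ‖h₁ z‖ ≤ M / 2 := fun z hz => by
    have := (convex_ball c r).norm_image_sub_le_of_norm_hasDerivWithin_le (C := 2 * K * M)
      (fun w hw => (hh₁ w hw).hasDerivWithinAt) (fun w hw => ?_) hc hz
    · rw [h₁c, sub_zero] at this
      refine this.trans ?_
      calc 2 * K * M * ‖z - c‖ ≤ 2 * K * M * r := by gcongr; exact hz' z hz
        _ = (4 * K * r) * (M / 2) := by ring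
        _ ≤ 1 * (M / 2) := by gcongr
        _ = M / 2 := one_mul _
    · simp only [Pi.neg_apply, Pi.add_apply, Pi.mul_apply, norm_neg]
      calc ‖p w * f₁ w + q w * f w‖ ≤ ‖p w‖ * ‖f₁ w‖ + ‖q w‖ * ‖f w‖ := by
            rw [← norm_mul, ← norm_mul]; exact norm_add_le _ _
        _ ≤ K * M + K * M := by
            gcongr
            exacts [hpK w hw, hf₁M w hw, hqK w hw, hfM w hw]
        _ = 2 * K * M := by ring
  refine ⟨h, h₁, hh, fun z hz => by simpa using hh₁ z hz, hc0, h₁c, fun z hz => ?_, b1⟩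
  have := (convex_ball c r).norm_image_sub_le_of_norm_hasDerivWithin_le
    (fun w hw => (hh w hw).hasDerivWithinAt) b1 hc hz
  rw [hc0, sub_zero] at this
  refine this.trans ?_
  calc M / 2 * ‖z - c‖ ≤ M / 2 * 1 := by gcongr; exact (hz' z hz).trans hr1
    _ = M / 2 := mul_one _

/-- On a small disk, the equation has solutions with arbitrary Cauchy data at the centre. -/
theorem exists_solution_ball (hr : 0 < r) (hr1 : r ≤ 1)
    (hp : DifferentiableOn ℂ p (ball c r)) (hq : DifferentiableOn ℂ q (ball c r))
    (hpK : ∀ z ∈ ball c r, ‖p z‖ ≤ K) (hqK : ∀ z ∈ ball c r, ‖q z‖ ≤ K) (hK : 4 * K * r ≤ 1)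
    (a b : ℂ) : ∃ f : ℂ → ℂ, (∀ z ∈ ball c r, IsSolutionAt p q f z) ∧ f c = a ∧ deriv f c = b := by
  have hc : c ∈ ball c r := mem_ball_self hr
  have hK0 : 0 ≤ K := (norm_nonneg _).trans (hpK c hc)
  set M : ℝ := ‖a‖ + ‖b‖ with hM
  have hM0 : 0 ≤ M := by positivity
  -- Picard iteration as a series: a term is a pair (correction, its derivative), and the geometric
  -- bound makes the series converge. The affine initial term carries the Cauchy data, and all later
  -- terms vanish at c together with their derivatives.
  let P : ℕ → (ℂ → ℂ) × (ℂ → ℂ) → Prop := fun n f =>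
    (∀ z ∈ ball c r, HasDerivAt f.1 (f.2 z) z) ∧ DifferentiableOn ℂ f.2 (ball c r) ∧
      (∀ z ∈ ball c r, ‖f.1 z‖ ≤ M / 2 ^ n) ∧ ∀ z ∈ ball c r, ‖f.2 z‖ ≤ M / 2 ^ n
  have step : ∀ n f, P n f → ∃ h : (ℂ → ℂ) × (ℂ → ℂ), P (n + 1) h ∧
      (∀ z ∈ ball c r, HasDerivAt h.2 (-(p z * f.2 z + q z * f.1 z)) z) ∧
      h.1 c = 0 ∧ h.2 c = 0 := by
    rintro n f ⟨h1, h2, h3, h4⟩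
    obtain ⟨h, h', e1, e2, e3, e4, e5, e6⟩ := exists_double_primitive hr hr1 hp hq hpK hqK hK
      (fun z hz => (h1 z hz).differentiableAt.differentiableWithinAt) h2 h3 h4
    have e : M / 2 ^ (n + 1) = M / 2 ^ n / 2 := by rw [pow_succ, div_div]
    exact ⟨(h, h'), ⟨e1, fun z hz => (e2 z hz).differentiableAt.differentiableWithinAt,
      e ▸ e5, e ▸ e6⟩, e2, e3, e4⟩
  choose! N hN using step
  let s : ℕ → (ℂ → ℂ) × (ℂ → ℂ) := fun n =>
    Nat.rec (fun z => a + b * (z - c), fun _ => b) (fun n f => N n f) n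
  have hP : ∀ n, P n (s n) := by
    intro n
    induction n with
    | zero =>
      refine ⟨fun z _ => ?_, differentiableOn_const _, fun z hz => ?_, fun z _ => ?_⟩
      · simpa [s] using (((hasDerivAt_id z).sub_const c).const_mul b).const_add a
      · simp only [s, pow_zero, div_one]
        calc ‖a + b * (z - c)‖ ≤ ‖a‖ + ‖b‖ * ‖z - c‖ := by
              rw [← norm_mul]; exact norm_add_le _ _
          _ ≤ ‖a‖ + ‖b‖ * 1 := by gcongr; exact (mem_ball_iff_norm.1 hz).le.trans hr1
          _ = M := by rw [mul_one]
      · simp [s, hM]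
    | succ n ih => exact (hN n (s n) ih).1
  have hs : ∀ n, (∀ z ∈ ball c r,
      HasDerivAt (s (n + 1)).2 (-(p z * (s n).2 z + q z * (s n).1 z)) z) ∧
      (s (n + 1)).1 c = 0 ∧ (s (n + 1)).2 c = 0 := fun n => (hN n (s n) (hP n)).2
  have hu : Summable fun n : ℕ => M / 2 ^ n := by
    simpa [div_eq_mul_inv] using summable_geometric_two.mul_left M
  have sum1 : ∀ z ∈ ball c r, Summable fun n => (s n).1 z := fun z hz =>
    .of_norm_bounded hu fun n => (hP n).2.2.1 z hz
  have sum2 : ∀ z ∈ ball c r, Summable fun n => (s n).2 z := fun z hz =>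
    .of_norm_bounded hu fun n => (hP n).2.2.2 z hz
  -- Second derivatives of the terms: 0 for the affine one, and for term n + 1 the right-hand side
  -- formed from term n. Summed with this shift, they reproduce the equation.
  let g : ℕ → ℂ → ℂ := fun n => n.casesOn (fun _ => 0)
    fun n z => -(p z * (s n).2 z + q z * (s n).1 z)
  have hg0 : ∀ z, g 0 z = 0 := fun _ => rfl
  have hgs : ∀ n z, g (n + 1) z = -(p z * (s n).2 z + q z * (s n).1 z) := fun _ _ => rfl
  have hg : ∀ n, ∀ z ∈ ball c r, HasDerivAt (s n).2 (g n z) z := by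
    rintro (_ | n) z hz
    · exact hasDerivAt_const z b
    · exact (hs n).1 z hz
  have hgM : ∀ n, ∀ z ∈ ball c r, ‖g n z‖ ≤ 4 * K * (M / 2 ^ n) := by
    rintro (_ | n) z hz
    · rw [hg0, norm_zero]; positivity
    · rw [hgs, norm_neg]
      calc ‖p z * (s n).2 z + q z * (s n).1 z‖
          ≤ ‖p z‖ * ‖(s n).2 z‖ + ‖q z‖ * ‖(s n).1 z‖ := by
            rw [← norm_mul, ← norm_mul]; exact norm_add_le _ _
        _ ≤ K * (M / 2 ^ n) + K * (M / 2 ^ n) := by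
            gcongr
            exacts [hpK z hz, (hP n).2.2.2 z hz, hqK z hz, (hP n).2.2.1 z hz]
        _ = 4 * K * (M / 2 ^ (n + 1)) := by rw [pow_succ]; field_simp; ring
  let f : ℂ → ℂ := fun z => ∑' n, (s n).1 z
  let f₁ : ℂ → ℂ := fun z => ∑' n, (s n).2 z
  have hf : ∀ z ∈ ball c r, HasDerivAt f (f₁ z) z := fun z hz =>
    hasDerivAt_tsum_of_isPreconnected hu isOpen_ball (convex_ball c r).isPreconnected
      (fun n w hw => (hP n).1 w hw) (fun n w hw => (hP n).2.2.2 w hw) hc (sum1 c hc) hz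
  have hf₁ : ∀ z ∈ ball c r, HasDerivAt f₁ (-(p z * f₁ z + q z * f z)) z := fun z hz => by
    have h1 := hasDerivAt_tsum_of_isPreconnected (hu.mul_left (4 * K)) isOpen_ball
      (convex_ball c r).isPreconnected hg hgM hc (sum2 c hc) hz
    have h2 : ∑' n, g n z = -(p z * f₁ z + q z * f z) := by
      have hsum : Summable fun n => g n z := .of_norm_bounded (hu.mul_left (4 * K))
        fun n => hgM n z hz
      rw [hsum.tsum_eq_zero_add, hg0, zero_add]
      simp only [hgs, f, f₁]
      rw [tsum_neg, ((sum2 z hz).mul_left _).tsum_add ((sum1 z hz).mul_left _), tsum_mul_left,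
        tsum_mul_left]
    exact h2 ▸ h1
  have hev : ∀ z ∈ ball c r, ∀ᶠ w in 𝓝 z, w ∈ ball c r := fun z hz => isOpen_ball.mem_nhds hz
  refine ⟨f, fun z hz => ⟨?_, ?_⟩, ?_, ?_⟩
  · exact DifferentiableOn.analyticAt
      (fun w hw => (hf w hw).differentiableAt.differentiableWithinAt) (hev z hz)
  · filter_upwards [hev z hz] with w hw
    have : deriv f =ᶠ[𝓝 w] f₁ := (hev w hw).mono fun x hx => (hf x hx).deriv
    rw [this.deriv_eq, (hf₁ w hw).deriv, this.self_of_nhds]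
    ring
  · simp only [f]
    rw [(sum1 c hc).tsum_eq_zero_add]
    simp only [(hs _).2.1, tsum_zero]
    simp [s]
  · rw [(hf c hc).deriv]
    simp only [f₁]
    rw [(sum2 c hc).tsum_eq_zero_add]
    simp only [(hs _).2.2, tsum_zero]
    simp [s]

/-- Near a regular point every germ of a solution extends to a fixed neighbourhood. -/
theorem exists_nhds_solution_extends {z : ℂ} (hp : AnalyticAt ℂ p z) (hq : AnalyticAt ℂ q z) :
    ∃ U ∈ 𝓝 z, ∀ w ∈ U, ∀ f, IsSolutionAt p q f w →
      ∃ f', (∀ x ∈ U, IsSolutionAt p q f' x) ∧ f' =ᶠ[𝓝 w] f := by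
  have hbp := hp.continuousAt.norm.eventually (gt_mem_nhds (lt_add_one ‖p z‖))
  have hbq := hq.continuousAt.norm.eventually (gt_mem_nhds (lt_add_one ‖q z‖))
  obtain ⟨R, hR, hB⟩ := Metric.eventually_nhds_iff_ball.1
    ((hp.eventually_analyticAt.and hq.eventually_analyticAt).and (hbp.and hbq))
  set K : ℝ := ‖p z‖ + ‖q z‖ + 1 with hK
  have hK0 : 0 < K := by positivity
  -- For w within r / 2 of z, the disk of radius r about w contains the disk of radius r / 2 about z
  -- and stays inside the disk of radius R, where K bounds the coefficients. One neighbourhood thus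
  -- serves all base points w.
  set r : ℝ := min (R / 2) (min 1 (1 / (4 * K))) with hr
  have hr0 : 0 < r := by positivity
  have hr1 : r ≤ 1 := (min_le_right _ _).trans (min_le_left _ _)
  have hrR : r ≤ R / 2 := min_le_left _ _
  have hrK : 4 * K * r ≤ 1 := by
    have : r ≤ 1 / (4 * K) := (min_le_right _ _).trans (min_le_right _ _)
    rw [le_div_iff₀ (by positivity)] at this
    linarith
  refine ⟨ball z (r / 2), ball_mem_nhds _ (by positivity), fun w hw f hf => ?_⟩
  have hwz : dist w z < r / 2 := hw
  have hsub : ball w r ⊆ ball z R := ball_subset_ball' (by linarith)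
  obtain ⟨f', hf', e0, e1⟩ := exists_solution_ball (p := p) (q := q) (K := K) hr0 hr1
    (fun x hx => (hB x (hsub hx)).1.1.differentiableAt.differentiableWithinAt)
    (fun x hx => (hB x (hsub hx)).1.2.differentiableAt.differentiableWithinAt)
    (fun x hx => (hB x (hsub hx)).2.1.le.trans (by rw [hK]; linarith [norm_nonneg (q z)]))
    (fun x hx => (hB x (hsub hx)).2.2.le.trans (by rw [hK]; linarith [norm_nonneg (p z)]))
    hrK (f w) (deriv f w)
  refine ⟨f', fun x hx => hf' x ?_, ?_⟩
  · have hxz : dist x z < r / 2 := hx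
    rw [mem_ball]
    linarith [dist_triangle_right x w z]
  · have hw' : w ∈ ball z R := hsub (mem_ball_self hr0)
    have hsol := hf' w (mem_ball_self hr0)
    have := (hsol.lin hf 1 (-1)).eventuallyEq_zero (hB w hw').1.1 (hB w hw').1.2
      (by rw [e0]; ring) (by rw [deriv_lin hsol.1 hf.1, e1]; ring)
    filter_upwards [this] with x hx
    linear_combination hx

end Existence

theorem eventually_eq_of_hasDerivAt_zero {f : ℂ → ℂ} {z : ℂ}
    (h : ∀ᶠ w in 𝓝 z, HasDerivAt f 0 w) : ∀ᶠ w in 𝓝 z, f w = f z := by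
  obtain ⟨r, hr, hB⟩ := Metric.eventually_nhds_iff_ball.1 h
  refine Metric.eventually_nhds_iff_ball.2 ⟨r, hr, fun w hw => ?_⟩
  exact (convex_ball z r).is_const_of_fderivWithin_eq_zero (𝕜 := ℂ)
    (fun x hx => (hB x hx).differentiableAt.differentiableWithinAt)
    (fun x hx => by
      rw [fderivWithin_of_isOpen Metric.isOpen_ball hx]
      ext
      simp [(hB x hx).deriv]) hw (Metric.mem_ball_self hr)

/-! ### Continuation of solutions -/

section Continuation

variable {p q : ℂ → ℂ} {a b : ℂ} {γ : Path a b}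

theorem exists_isContinuation (hp : ∀ t, AnalyticAt ℂ p (γ t)) (hq : ∀ t, AnalyticAt ℂ q (γ t))
    {f : ℂ → ℂ} (hf : IsSolutionAt p q f a) : ∃ F, IsContinuation p q γ F ∧ F 0 = f := by
  obtain ⟨F, hF, h0⟩ := exists_continues (S := fun z f => IsSolutionAt p q f z) γ
    (fun t => exists_nhds_solution_extends (hp t) (hq t)) hf
  exact ⟨F, isContinuation_iff.2 hF, h0⟩

theorem IsContinuation.eventuallyEq {p' q' : ℂ → ℂ} {F F' : I → ℂ → ℂ}
    (hF : IsContinuation p q γ F) (hF' : IsContinuation p' q' γ F') {t₀ : I}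
    (h : F t₀ =ᶠ[𝓝 (γ t₀)] F' t₀) (t : I) : F t =ᶠ[𝓝 (γ t)] F' t :=
  (isContinuation_iff.1 hF).eventuallyEq (isContinuation_iff.1 hF') (fun _ _ h => h.1)
    (fun _ _ h => h.1) h t

theorem IsContinuation.sum {F : Fin 2 → I → ℂ → ℂ} (hF : ∀ i, IsContinuation p q γ (F i))
    (c : Fin 2 → ℂ) : IsContinuation p q γ (fun t w => ∑ i, c i * F i t w) := by
  refine ⟨fun t => IsSolutionAt.sum (fun i => (hF i).sol t) c, fun t => ?_⟩
  filter_upwards [(hF 0).compat t, (hF 1).compat t] with s h0 h1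
  filter_upwards [h0, h1] with w e0 e1
  simp only [Fin.sum_univ_two, e0, e1]

/-- The continuation of a fundamental system is a fundamental system. -/
theorem IsContinuation.isFundamentalAt {F : Fin 2 → I → ℂ → ℂ}
    (hF : ∀ i, IsContinuation p q γ (F i)) {t₀ : I}
    (h : IsFundamentalAt p q (fun i => F i t₀) (γ t₀)) (t : I) :
    IsFundamentalAt p q (fun i => F i t) (γ t) := by
  refine ⟨fun i => (hF i).sol t, fun c hc => h.indep c ?_⟩
  -- A linear relation at t continues to t₀ by comparison with the zero solution, written as the
  -- combination with zero coefficients.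
  have hz : IsContinuation p q γ (fun t w => ∑ i, (0 : Fin 2 → ℂ) i * F i t w) :=
    IsContinuation.sum hF 0
  have := (IsContinuation.sum hF c).eventuallyEq hz (t₀ := t)
    (hc.mono fun w hw => by simpa using hw) t₀
  filter_upwards [this] with w hw
  simpa using hw

/-- Without a term of the first order, the Wronskian is constant under continuation. -/
theorem wronskian_continuation {F : Fin 2 → I → ℂ → ℂ}
    (hF : ∀ i, IsContinuation 0 q γ (F i)) (t t' : I) :
    wronskian (fun i => F i t) (γ t) = wronskian (fun i => F i t') (γ t') := by
  have hconst : IsLocallyConstant fun t => wronskian (fun i => F i t) (γ t) := by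
    refine (IsLocallyConstant.iff_eventually_eq _).2 fun t => ?_
    have hloc : ∀ᶠ z in 𝓝 (γ t),
        wronskian (fun i => F i t) z = wronskian (fun i => F i t) (γ t) := by
      have hd : ∀ᶠ z in 𝓝 (γ t), HasDerivAt (wronskian fun i => F i t) 0 z := by
        filter_upwards [((hF 0).sol t).eventually, ((hF 1).sol t).eventually] with z h0 h1
        have e0 := h0.2.self_of_nhds
        have e1 := h1.2.self_of_nhds
        simp only [Pi.zero_apply, zero_mul, add_zero] at e0 e1
        refine ((h0.1.differentiableAt.hasDerivAt.mul h1.1.deriv.differentiableAt.hasDerivAt).sub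
          (h1.1.differentiableAt.hasDerivAt.mul h0.1.deriv.differentiableAt.hasDerivAt)).congr_deriv
          ?_
        linear_combination F 0 t z * e1 - F 1 t z * e0
      exact eventually_eq_of_hasDerivAt_zero hd
    filter_upwards [(hF 0).compat t, (hF 1).compat t,
      γ.continuous.continuousAt.eventually hloc] with s h0 h1 h2
    rw [← h2]
    simp only [wronskian, h0.deriv_eq, h1.deriv_eq, h0.self_of_nhds, h1.self_of_nhds]
  exact hconst.apply_eq_of_preconnectedSpace t t'

end Continuation

/-! ### Half periods of the Weierstrass function -/

section Weierstrass

open PeriodPair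
open scoped PeriodPair

variable {L : PeriodPair}

theorem hasDerivAt_weierstrassP {z : ℂ} (hz : z ∉ L.lattice) :
    HasDerivAt ℘[L] (℘'[L] z) z := by
  have := (L.analyticOnNhd_weierstrassP z hz).differentiableAt.hasDerivAt
  rwa [deriv_weierstrassP] at this

theorem eventually_notMem_lattice {z : ℂ} (hz : z ∉ L.lattice) : ∀ᶠ w in 𝓝 z, w ∉ L.lattice :=
  L.isClosed_lattice.isOpen_compl.mem_nhds hz

theorem sub_half_notMem_lattice {w : ℂ} (hw2 : 2 * w ∈ L.lattice) {z : ℂ}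
    (hz : 2 * z ∉ L.lattice) : z - w ∉ L.lattice := fun h => by
  refine hz ?_
  have := L.lattice.add_mem (L.lattice.add_mem h h) hw2
  convert this using 1
  ring

theorem notMem_lattice_of_two_mul {z : ℂ} (hz : 2 * z ∉ L.lattice) : z ∉ L.lattice := fun h =>
  hz (by rw [two_mul]; exact L.lattice.add_mem h h)

/-- `℘` is symmetric about a half period. -/
theorem weierstrassP_half_sub {w : ℂ} (hw2 : 2 * w ∈ L.lattice) (z : ℂ) :
    ℘[L] (w - z) = ℘[L] (w + z) := by
  rw [← weierstrassP_neg, ← L.weierstrassP_add_coe _ ⟨2 * w, hw2⟩]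
  congr 1
  ring

/-- ℘' is odd, and w and -w differ by the period 2 w. -/
theorem derivWeierstrassP_half {w : ℂ} (hw2 : 2 * w ∈ L.lattice) : ℘'[L] w = 0 := by
  have h1 : ℘'[L] (-w) = ℘'[L] w := by
    rw [← L.derivWeierstrassP_add_coe _ ⟨2 * w, hw2⟩]
    congr 1
    ring
  rw [derivWeierstrassP_neg] at h1
  linear_combination -(1 / 2 : ℂ) * h1

/-- For a half period `w`, the product of `℘ - ℘ w` and its translate by `w` is constant. -/
theorem exists_weierstrassP_mul_translate_eq {w : ℂ} (hw : w ∉ L.lattice)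
    (hw2 : 2 * w ∈ L.lattice) :
    ∃ C : ℂ, ∀ z, z ∉ L.lattice → z - w ∉ L.lattice →
      (℘[L] (z - w) - ℘[L] w) * (℘[L] z - ℘[L] w) = C := by
  classical
  set e := ℘[L] w
  let g : ℂ → ℂ := fun z => ℘[L] (w + z) - e
  have hgan : AnalyticAt ℂ g 0 := by
    have : AnalyticAt ℂ ℘[L] (w + 0) := L.analyticOnNhd_weierstrassP _ (by simpa using hw)
    exact (this.comp_of_eq (f := fun z => w + z) (by fun_prop) rfl).sub analyticAt_const
  have hg0 : g 0 = 0 := by simp [g, e]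
  have hg1 : deriv g 0 = 0 := by
    have h1 : HasDerivAt ℘[L] (℘'[L] (w + 0)) (w + 0) := hasDerivAt_weierstrassP (by simpa using hw)
    have h2 := (h1.comp_const_add w 0).sub_const e
    rw [h2.deriv, add_zero, derivWeierstrassP_half hw2]
  -- The double zero of ℘ - e at w, which cancels the double pole of ℘ at 0.
  obtain ⟨k, hk, hgk⟩ : ∃ k : ℂ → ℂ, AnalyticAt ℂ k 0 ∧ ∀ᶠ z in 𝓝 0, g z = z ^ 2 * k z := by
    have e1 := hgan.analyticOrderAt_deriv_add_one
    have e2 := hgan.deriv.analyticOrderAt_deriv_add_one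
    simp only [hg0, hg1, sub_zero] at e1 e2
    have : ((2 : ℕ) : ℕ∞) ≤ analyticOrderAt g 0 := by
      rw [← e1, ← e2, add_assoc, one_add_one_eq_two]
      exact le_add_self
    obtain ⟨k, hk, h⟩ := (natCast_le_analyticOrderAt hgan).1 this
    exact ⟨k, hk, h.mono fun z hz => by simpa using hz⟩
  -- The product with its singularities filled in; `k 0` is the limit at 0, and the two symmetries
  -- below carry it to every other excluded point.
  let F : ℂ → ℂ := fun z => if z ∈ L.lattice ∨ z - w ∈ L.lattice then k 0
    else (℘[L] (z - w) - e) * (℘[L] z - e)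
  have hFl : ∀ z, ∀ l ∈ L.lattice, F (z + l) = F z := fun z l hl => by
    have h1 : z + l ∈ L.lattice ↔ z ∈ L.lattice := L.lattice.add_mem_iff_left hl
    have h2 : z + l - w ∈ L.lattice ↔ z - w ∈ L.lattice := by
      rw [add_sub_right_comm]; exact L.lattice.add_mem_iff_left hl
    have h3 := L.weierstrassP_add_coe z ⟨l, hl⟩
    have h4 := L.weierstrassP_add_coe (z - w) ⟨l, hl⟩
    simp only [F, h1, h2]
    rw [h3, add_sub_right_comm, h4]
  -- Since 2 w is a period, translation by w only exchanges the two factors.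
  have hFw : ∀ z, F (z - w) = F z := fun z => by
    have h1 : z - w - w ∈ L.lattice ↔ z ∈ L.lattice := by
      have : z - w - w = z + -(2 * w) := by ring
      rw [this]; exact L.lattice.add_mem_iff_left (L.lattice.neg_mem hw2)
    have h2 : ℘[L] (z - w - w) = ℘[L] z := by
      have h := L.weierstrassP_sub_coe z ⟨2 * w, hw2⟩
      rw [← h]; congr 1; ring
    simp only [F, h1, h2, or_comm (a := z ∈ L.lattice), mul_comm (℘[L] z - e)]
  have hF0 : AnalyticAt ℂ F 0 := by
    have han : AnalyticAt ℂ (fun z => g z * (℘[L - (0 : ℂ)] z - e) + k z) 0 :=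
      (hgan.mul ((L.analyticAt_weierstrassPExcept 0).sub analyticAt_const)).add hk
    refine han.congr ?_
    have hz1 : ∀ᶠ z : ℂ in 𝓝 0, z - w ∉ L.lattice := by
      have hc : ContinuousAt (fun z : ℂ => z - w) 0 := by fun_prop
      refine hc.eventually (eventually_notMem_lattice ?_)
      exact fun h => hw (by simpa using h)
    filter_upwards [hgk, hz1, L.compl_lattice_sdiff_singleton_mem_nhds 0] with z h1 h2 h3
    by_cases hz : z = 0
    · subst hz
      simp [F, hg0]
    · have h4 : z ∉ L.lattice := fun h => h3 ⟨h, hz⟩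
      have h5 : ℘[L] (z - w) - e = g z := by
        simp only [g]
        rw [← weierstrassP_neg, neg_sub, weierstrassP_half_sub hw2]
      have h6 := L.weierstrassPExcept_def 0 z
      simp only [ZeroMemClass.coe_zero, sub_zero] at h6
      simp only [F, h4, h2, or_self, if_false, h5, h6]
      rw [h1]
      field_simp
      ring
  have hFlat : ∀ z ∈ L.lattice, AnalyticAt ℂ F z := fun z hz => by
    have h1 : AnalyticAt ℂ (fun x => F (x - z)) z :=
      hF0.comp_of_eq (f := fun x => x - z) (by fun_prop) (sub_self z)
    refine h1.congr (.of_forall fun x => ?_)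
    simp only [sub_eq_add_neg]
    exact hFl x _ (L.lattice.neg_mem hz)
  have hF : ∀ z, AnalyticAt ℂ F z := fun z => by
    by_cases hz : z ∈ L.lattice
    · exact hFlat z hz
    by_cases hzw : z - w ∈ L.lattice
    · have h1 : AnalyticAt ℂ (fun x => F (x - w)) z :=
        (hFlat _ hzw).comp_of_eq (f := fun x => x - w) (by fun_prop) rfl
      exact h1.congr (.of_forall fun x => hFw x)
    · have h1 : AnalyticAt ℂ (fun z => (℘[L] (z - w) - e) * (℘[L] z - e)) z :=
        (((L.analyticOnNhd_weierstrassP _ hzw).comp_of_eq (f := fun x => x - w)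
          (by fun_prop) rfl).sub analyticAt_const).mul
          ((L.analyticOnNhd_weierstrassP _ hz).sub analyticAt_const)
      refine h1.congr ?_
      have hc : ContinuousAt (fun z : ℂ => z - w) z := by fun_prop
      filter_upwards [eventually_notMem_lattice hz,
        hc.eventually (eventually_notMem_lattice hzw)] with x hx hx'
      simp only [F, hx, hx', or_self, if_false]
  -- Entire and doubly periodic, hence bounded and constant by Liouville.
  have hd : Differentiable ℂ F := fun z => (hF z).differentiableAt
  have hb := (IsZLattice.isCompact_range_of_periodic L.lattice _ hd.continuous
    fun z l hl => hFl z l hl).isBounded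
  refine ⟨F 0, fun z hz hzw => ?_⟩
  rw [← hd.apply_eq_apply_of_bounded hb z 0]
  simp only [F, hz, hzw, or_self, if_false]

theorem two_mul_halfPeriod_mem (i : Fin 4) : 2 * halfPeriod L i ∈ L.lattice := by
  have h1 := L.ω₁_mem_lattice
  have h2 := L.ω₂_mem_lattice
  fin_cases i
  · simp [halfPeriod]
  · simpa [halfPeriod, mul_div_cancel₀] using h1
  · simpa [halfPeriod, mul_div_cancel₀] using h2
  · simpa [halfPeriod, mul_add, mul_div_cancel₀] using L.lattice.add_mem h1 h2

theorem halfPeriod_notMem {i : Fin 4} (hi : i ≠ 0) : halfPeriod L i ∉ L.lattice := by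
  fin_cases i
  · exact absurd rfl hi
  · exact L.ω₁_div_two_notMem_lattice
  · exact L.ω₂_div_two_notMem_lattice
  · have := (L.mul_ω₁_add_mul_ω₂_mem_lattice (α := 1 / 2) (β := 1 / 2)).not.mpr (by norm_num)
    simpa [halfPeriod, inv_mul_eq_div] using this

theorem weierstrassP_halfPeriod_sub {i j k : Fin 4} {l : ℂ} (hl : l ∈ L.lattice)
    (h : halfPeriod L i - halfPeriod L j = halfPeriod L k + l) :
    ℘[L] (halfPeriod L i - halfPeriod L j) = halfValue L k := by
  rw [h]; exact L.weierstrassP_add_coe _ ⟨l, hl⟩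

/-- The translation formula of `℘` by the half period `ω j`. -/
theorem weierstrassP_sub_halfPeriod {i j k : Fin 4} {l : ℂ} (hi : i ≠ 0) (hj : j ≠ 0) (hk : k ≠ 0)
    (hl : l ∈ L.lattice) (h : halfPeriod L i - halfPeriod L j = halfPeriod L k + l)
    {z : ℂ} (hz : 2 * z ∉ L.lattice) :
    (℘[L] (z - halfPeriod L j) - halfValue L j) * (℘[L] z - halfValue L j) =
      (halfValue L k - halfValue L j) * (halfValue L i - halfValue L j) := by
  obtain ⟨C, hC⟩ := exists_weierstrassP_mul_translate_eq (halfPeriod_notMem hj)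
    (two_mul_halfPeriod_mem (L := L) j)
  have h1 := hC z (notMem_lattice_of_two_mul hz)
    (sub_half_notMem_lattice (two_mul_halfPeriod_mem j) hz)
  -- The constant is read off at z = ω i, where z - ω j is ω k up to a period.
  have h2 := hC (halfPeriod L i) (halfPeriod_notMem hi) (by
    rw [h, L.lattice.add_mem_iff_left hl]; exact halfPeriod_notMem hk)
  rw [weierstrassP_halfPeriod_sub hl h] at h2
  exact h1.trans h2.symm

theorem weierstrassP_sub_halfPeriod_one {z : ℂ} (hz : 2 * z ∉ L.lattice) :
    (℘[L] (z - halfPeriod L 1) - halfValue L 1) * (℘[L] z - halfValue L 1) =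
      (halfValue L 3 - halfValue L 1) * (halfValue L 2 - halfValue L 1) := by
  refine weierstrassP_sub_halfPeriod (i := 2) (l := -L.ω₁) (by decide) (by decide) (by decide)
    (L.lattice.neg_mem L.ω₁_mem_lattice) ?_ hz
  simp [halfPeriod]
  ring

theorem weierstrassP_sub_halfPeriod_two {z : ℂ} (hz : 2 * z ∉ L.lattice) :
    (℘[L] (z - halfPeriod L 2) - halfValue L 2) * (℘[L] z - halfValue L 2) =
      (halfValue L 3 - halfValue L 2) * (halfValue L 1 - halfValue L 2) := by
  refine weierstrassP_sub_halfPeriod (i := 1) (l := -L.ω₂) (by decide) (by decide) (by decide)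
    (L.lattice.neg_mem L.ω₂_mem_lattice) ?_ hz
  simp [halfPeriod]
  ring

theorem weierstrassP_sub_halfPeriod_three {z : ℂ} (hz : 2 * z ∉ L.lattice) :
    (℘[L] (z - halfPeriod L 3) - halfValue L 3) * (℘[L] z - halfValue L 3) =
      (halfValue L 2 - halfValue L 3) * (halfValue L 1 - halfValue L 3) := by
  refine weierstrassP_sub_halfPeriod (i := 1) (l := -L.ω₂) (by decide) (by decide) (by decide)
    (L.lattice.neg_mem L.ω₂_mem_lattice) ?_ hz
  simp [halfPeriod]
  ring

/-- The three values of `℘` at the half periods are distinct. -/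
def DistinctHalfValues (L : PeriodPair) : Prop :=
  halfValue L 2 - halfValue L 1 ≠ 0 ∧ halfValue L 3 - halfValue L 1 ≠ 0 ∧
    halfValue L 3 - halfValue L 2 ≠ 0

/-- Each difference is a factor in a translation formula whose right-hand side is non-zero, so no
count of the zeros of an elliptic function is required. -/
theorem weierstrassP_ne_halfValue (hL : DistinctHalfValues L) {z : ℂ} (hz : 2 * z ∉ L.lattice) :
    ℘[L] z - halfValue L 1 ≠ 0 ∧ ℘[L] z - halfValue L 2 ≠ 0 ∧ ℘[L] z - halfValue L 3 ≠ 0 := by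
  obtain ⟨h21, h31, h32⟩ := hL
  have h12 : halfValue L 1 - halfValue L 2 ≠ 0 := by rwa [← neg_ne_zero, neg_sub]
  have h13 : halfValue L 1 - halfValue L 3 ≠ 0 := by rwa [← neg_ne_zero, neg_sub]
  have h23 : halfValue L 2 - halfValue L 3 ≠ 0 := by rwa [← neg_ne_zero, neg_sub]
  exact ⟨right_ne_zero_of_mul (weierstrassP_sub_halfPeriod_one hz ▸ mul_ne_zero h31 h21),
    right_ne_zero_of_mul (weierstrassP_sub_halfPeriod_two hz ▸ mul_ne_zero h32 h12),
    right_ne_zero_of_mul (weierstrassP_sub_halfPeriod_three hz ▸ mul_ne_zero h23 h13)⟩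

theorem cubic_halfValue {i : Fin 4} (hi : i ≠ 0) :
    4 * halfValue L i ^ 3 - L.g₂ * halfValue L i - L.g₃ = 0 := by
  have := L.derivWeierstrassP_sq _ (halfPeriod_notMem hi)
  rw [derivWeierstrassP_half (two_mul_halfPeriod_mem i)] at this
  rw [halfValue, ← this]
  ring

/-- Vieta for the cubic 4 t³ - g₂ t - g₃: the combination of its three root equations that
eliminates g₂ and g₃ is four times the Vandermonde product times the sum of the roots. -/
theorem sum_halfValue (hL : DistinctHalfValues L) :
    halfValue L 1 + halfValue L 2 + halfValue L 3 = 0 := by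
  obtain ⟨h21, h31, h32⟩ := hL
  have c1 := cubic_halfValue (L := L) (i := 1) (by decide)
  have c2 := cubic_halfValue (L := L) (i := 2) (by decide)
  have c3 := cubic_halfValue (L := L) (i := 3) (by decide)
  refine (mul_eq_zero.1 (?_ : (4 * (halfValue L 2 - halfValue L 1) *
    (halfValue L 3 - halfValue L 1) * (halfValue L 3 - halfValue L 2)) * _ = 0)).resolve_left ?_
  · linear_combination (halfValue L 3 - halfValue L 2) * c1 -
      (halfValue L 3 - halfValue L 1) * c2 + (halfValue L 2 - halfValue L 1) * c3
  · exact mul_ne_zero (mul_ne_zero (mul_ne_zero (by norm_num) h21) h31) h32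

theorem g₂_eq_halfValue (hL : DistinctHalfValues L) :
    L.g₂ = -4 * (halfValue L 1 * halfValue L 2 + halfValue L 1 * halfValue L 3 +
      halfValue L 2 * halfValue L 3) := by
  have hs := sum_halfValue hL
  have h21 := hL.1
  have c1 := cubic_halfValue (L := L) (i := 1) (by decide)
  have c2 := cubic_halfValue (L := L) (i := 2) (by decide)
  refine mul_left_cancel₀ h21 ?_
  linear_combination c1 - c2 + 4 * (halfValue L 2 - halfValue L 1) *
    (halfValue L 1 + halfValue L 2) * hs

/-- `℘'² = 4 (℘ - e₁) (℘ - e₂) (℘ - e₃)`. -/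
theorem derivWeierstrassP_sq_eq_prod (hL : DistinctHalfValues L) {z : ℂ} (hz : z ∉ L.lattice) :
    ℘'[L] z ^ 2 = 4 * (℘[L] z - halfValue L 1) * (℘[L] z - halfValue L 2) *
      (℘[L] z - halfValue L 3) := by
  rw [L.derivWeierstrassP_sq z hz]
  have c1 := cubic_halfValue (L := L) (i := 1) (by decide)
  linear_combination c1 - (℘[L] z - halfValue L 1) * g₂_eq_halfValue hL +
    (4 * ℘[L] z ^ 2 - 4 * halfValue L 1 ^ 2) * sum_halfValue hL

theorem derivWeierstrassP_ne_zero (hL : DistinctHalfValues L) {z : ℂ} (hz : 2 * z ∉ L.lattice) :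
    ℘'[L] z ≠ 0 := by
  obtain ⟨h1, h2, h3⟩ := weierstrassP_ne_halfValue hL hz
  have := derivWeierstrassP_sq_eq_prod hL (notMem_lattice_of_two_mul hz)
  intro h0
  rw [h0] at this
  exact mul_ne_zero (mul_ne_zero (mul_ne_zero (by norm_num : (4 : ℂ) ≠ 0) h1) h2) h3
    (by rw [← this]; ring)

/-- Differentiate ℘'² = 4 ℘³ - g₂ ℘ - g₃ and cancel ℘', which does not vanish away from the half
periods. -/
theorem deriv_derivWeierstrassP (hL : DistinctHalfValues L) {z : ℂ} (hz : 2 * z ∉ L.lattice) :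
    deriv ℘'[L] z = 6 * ℘[L] z ^ 2 - L.g₂ / 2 := by
  have hz' := notMem_lattice_of_two_mul hz
  have h1 := (L.analyticOnNhd_derivWeierstrassP z hz').differentiableAt.hasDerivAt
  have h2 := hasDerivAt_weierstrassP hz'
  have h3 : (fun w => ℘'[L] w ^ 2) =ᶠ[𝓝 z] fun w => 4 * ℘[L] w ^ 3 - L.g₂ * ℘[L] w - L.g₃ :=
    (eventually_notMem_lattice hz').mono fun w hw => L.derivWeierstrassP_sq w hw
  have h4 := ((h1.fun_pow 2).congr_of_eventuallyEq h3.symm).unique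
    ((((h2.fun_pow 3).const_mul 4).fun_sub (h2.const_mul L.g₂)).sub_const L.g₃)
  refine mul_left_cancel₀ (derivWeierstrassP_ne_zero hL hz) ?_
  norm_num at h4
  linear_combination h4 / 2

end Weierstrass

/-! ### The change of variables -/

section Transform

open PeriodPair
open scoped PeriodPair

variable {L : PeriodPair} {a : ℂ}

/-- Since division by zero gives 0, the assumption a ≠ 0 excludes e₂ = e₁ as well as e₃ = e₁; a ≠ 1
excludes e₃ = e₂. -/
theorem distinctHalfValues_of_param (ha₀ : a ≠ 0) (ha₁ : a ≠ 1)
    (ha : a = (halfValue L 3 - halfValue L 1) / (halfValue L 2 - halfValue L 1)) :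
    DistinctHalfValues L := by
  have h21 : halfValue L 2 - halfValue L 1 ≠ 0 := fun h => ha₀ (by rw [ha, h, div_zero])
  refine ⟨h21, fun h => ha₀ (by rw [ha, h, zero_div]), fun h => ha₁ ?_⟩
  rw [ha, sub_eq_zero.1 h, div_self h21]

/-- The half values in terms of `d = e₂ - e₁` and `a`. -/
theorem halfValue_eq (hL : DistinctHalfValues L)
    (ha : a = (halfValue L 3 - halfValue L 1) / (halfValue L 2 - halfValue L 1)) :
    halfValue L 1 = -(1 + a) * (halfValue L 2 - halfValue L 1) / 3 ∧
    halfValue L 2 = (2 - a) * (halfValue L 2 - halfValue L 1) / 3 ∧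
    halfValue L 3 = (2 * a - 1) * (halfValue L 2 - halfValue L 1) / 3 := by
  have h3 : halfValue L 3 - halfValue L 1 = a * (halfValue L 2 - halfValue L 1) := by
    rw [ha, div_mul_cancel₀ _ hL.1]
  have hs := sum_halfValue hL
  refine ⟨?_, ?_, ?_⟩
  · linear_combination hs / 3 - h3 / 3
  · linear_combination hs / 3 - h3 / 3
  · linear_combination hs / 3 + 2 * h3 / 3

theorem weierstrassP_eq_heunVar (hL : DistinctHalfValues L) (z : ℂ) :
    ℘[L] z = halfValue L 1 + (halfValue L 2 - halfValue L 1) * heunVar L z := by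
  rw [heunVar, mul_div_cancel₀ _ hL.1]
  ring

theorem heunVar_ne (hL : DistinctHalfValues L)
    (ha : a = (halfValue L 3 - halfValue L 1) / (halfValue L 2 - halfValue L 1)) {z : ℂ}
    (hz : z ∈ darbouxDomain L) : heunVar L z ≠ 0 ∧ heunVar L z - 1 ≠ 0 ∧ heunVar L z - a ≠ 0 := by
  obtain ⟨h1, h2, h3⟩ := weierstrassP_ne_halfValue hL hz
  refine ⟨div_ne_zero h1 hL.1, ?_, ?_⟩
  · rw [heunVar, div_sub_one hL.1]
    refine div_ne_zero ?_ hL.1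
    rwa [sub_sub_sub_cancel_right]
  · rw [heunVar, ha, ← sub_div]
    refine div_ne_zero ?_ hL.1
    rwa [sub_sub_sub_cancel_right]

theorem isOpen_darbouxDomain : IsOpen (darbouxDomain L) :=
  L.isClosed_lattice.isOpen_compl.preimage (f := fun z : ℂ => 2 * z) (by fun_prop)

/-- The derivative of `heunVar L`. -/
noncomputable def heunVarDeriv (L : PeriodPair) (z : ℂ) : ℂ :=
  ℘'[L] z / (halfValue L 2 - halfValue L 1)

theorem hasDerivAt_heunVar {z : ℂ} (hz : z ∈ darbouxDomain L) :
    HasDerivAt (heunVar L) (heunVarDeriv L z) z :=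
  ((hasDerivAt_weierstrassP (notMem_lattice_of_two_mul hz)).sub_const _).div_const _

theorem analyticAt_heunVar {z : ℂ} (hz : z ∈ darbouxDomain L) : AnalyticAt ℂ (heunVar L) z := by
  unfold heunVar
  simp only [div_eq_mul_inv]
  exact ((L.analyticOnNhd_weierstrassP z (notMem_lattice_of_two_mul hz)).sub
    analyticAt_const).mul analyticAt_const

theorem heunVar_add (z : ℂ) {l : ℂ} (hl : l ∈ L.lattice) : heunVar L (z + l) = heunVar L z := by
  unfold heunVar
  rw [L.weierstrassP_add_coe z ⟨l, hl⟩]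

theorem heunVarDeriv_ne_zero (hL : DistinctHalfValues L) {z : ℂ} (hz : z ∈ darbouxDomain L) :
    heunVarDeriv L z ≠ 0 := div_ne_zero (derivWeierstrassP_ne_zero hL hz) hL.1

theorem heunVarDeriv_sq (hL : DistinctHalfValues L)
    (ha : a = (halfValue L 3 - halfValue L 1) / (halfValue L 2 - halfValue L 1)) {z : ℂ}
    (hz : z ∈ darbouxDomain L) : heunVarDeriv L z ^ 2 =
      4 * (halfValue L 2 - halfValue L 1) * heunVar L z * (heunVar L z - 1) *
        (heunVar L z - a) := by
  have h1 := derivWeierstrassP_sq_eq_prod hL (notMem_lattice_of_two_mul hz)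
  have hd := hL.1
  rw [heunVarDeriv, div_pow, h1, heunVar, ha]
  field_simp
  ring

theorem hasDerivAt_heunVarDeriv (hL : DistinctHalfValues L)
    (ha : a = (halfValue L 3 - halfValue L 1) / (halfValue L 2 - halfValue L 1)) {z : ℂ}
    (hz : z ∈ darbouxDomain L) : HasDerivAt (heunVarDeriv L)
      (2 * (halfValue L 2 - halfValue L 1) * ((heunVar L z - 1) * (heunVar L z - a) +
        heunVar L z * (heunVar L z - a) + heunVar L z * (heunVar L z - 1))) z := by
  have h1 := (L.analyticOnNhd_derivWeierstrassP z
    (notMem_lattice_of_two_mul hz)).differentiableAt.hasDerivAt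
  refine (h1.div_const _).congr_deriv ?_
  obtain ⟨e1, e2, e3⟩ := halfValue_eq hL ha
  rw [deriv_derivWeierstrassP hL hz, weierstrassP_eq_heunVar hL z, g₂_eq_halfValue hL,
    div_eq_iff hL.1]
  generalize halfValue L 2 - halfValue L 1 = d at *
  rw [e1, e2, e3]
  ring

/-- The logarithmic derivative of `x ^ (-m₁/2) * (x - 1) ^ (-m₂/2) * (x - a) ^ (-m₃/2)`. -/
noncomputable def factorLogDeriv (m : Fin 4 → ℂ) (a x : ℂ) : ℂ :=
  -(m 1 / 2) / x - (m 2 / 2) / (x - 1) - (m 3 / 2) / (x - a)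

theorem hasDerivAt_factorLogDeriv (m : Fin 4 → ℂ) {x : ℂ} (h0 : x ≠ 0) (h1 : x - 1 ≠ 0)
    (h2 : x - a ≠ 0) : HasDerivAt (factorLogDeriv m a)
      (m 1 / 2 / x ^ 2 + m 2 / 2 / (x - 1) ^ 2 + m 3 / 2 / (x - a) ^ 2) x := by
  have e0 := (hasDerivAt_const x (-(m 1 / 2))).fun_div (hasDerivAt_id' x) h0
  have e1 := (hasDerivAt_const x (m 2 / 2)).fun_div ((hasDerivAt_id' x).sub_const 1) h1
  have e2 := (hasDerivAt_const x (m 3 / 2)).fun_div ((hasDerivAt_id' x).sub_const a) h2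
  refine ((e0.fun_sub e1).fun_sub e2).congr_deriv ?_
  ring

/-- With d = e₂ - e₁, the translation formulas turn ℘(z - ω i) - e i into d a / x, d (1 - a) / (x -
1) and d a (a - 1) / (x - a). The leftover constants are exactly the e i terms of `darbouxB`. -/
theorem darbouxQ_eq (hL : DistinctHalfValues L)
    (ha : a = (halfValue L 3 - halfValue L 1) / (halfValue L 2 - halfValue L 1)) {z : ℂ}
    (hz : z ∈ darbouxDomain L) (m : Fin 4 → ℂ) (B : ℂ) :
    darbouxQ L m (darbouxB L m a B) z = (halfValue L 2 - halfValue L 1) *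
      (-(m 0 * (m 0 + 1) * heunVar L z + m 1 * (m 1 + 1) * (a / heunVar L z) +
        m 2 * (m 2 + 1) * ((1 - a) / (heunVar L z - 1)) +
        m 3 * (m 3 + 1) * (a * (a - 1) / (heunVar L z - a))) -
      (B - a * ((m 1 + m 2) ^ 2 - m 3 * (m 3 + 1)) - ((m 1 + m 3) ^ 2 - m 2 * (m 2 + 1)))) := by
  obtain ⟨x0, x1, x2⟩ := heunVar_ne hL ha hz
  obtain ⟨e1, e2, e3⟩ := halfValue_eq hL ha
  have hd := hL.1
  have t1 := weierstrassP_sub_halfPeriod_one hz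
  have t2 := weierstrassP_sub_halfPeriod_two hz
  have t3 := weierstrassP_sub_halfPeriod_three hz
  have hP := weierstrassP_eq_heunVar hL z
  rw [hP] at t1 t2 t3
  have s1 : ℘[L] (z - halfPeriod L 1) =
      halfValue L 1 + (halfValue L 2 - halfValue L 1) * (a / heunVar L z) := by
    generalize halfValue L 2 - halfValue L 1 = d at *
    rw [e1, e3] at t1
    rw [e1]
    field_simp
    refine mul_left_cancel₀ hd ?_
    linear_combination 3 * t1
  have s2 : ℘[L] (z - halfPeriod L 2) =
      halfValue L 2 + (halfValue L 2 - halfValue L 1) * ((1 - a) / (heunVar L z - 1)) := by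
    generalize halfValue L 2 - halfValue L 1 = d at *
    rw [e1, e2, e3] at t2
    rw [e2]
    field_simp
    refine mul_left_cancel₀ hd ?_
    linear_combination 3 * t2
  have s3 : ℘[L] (z - halfPeriod L 3) =
      halfValue L 3 + (halfValue L 2 - halfValue L 1) * (a * (a - 1) / (heunVar L z - a)) := by
    generalize halfValue L 2 - halfValue L 1 = d at *
    rw [e1, e2, e3] at t3
    rw [e3]
    field_simp
    refine mul_left_cancel₀ hd ?_
    linear_combination 3 * t3
  have s0 : z - halfPeriod L 0 = z := by simp [halfPeriod]
  rw [darbouxQ, Fin.sum_univ_four, s0, s1, s2, s3, hP, darbouxB]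
  ring

/-- Divided by d, this is the coefficient of y' in the transformed equation; its vanishing is what
determines the exponents -m i / 2 of the factor. -/
theorem heunP_relation {γ δ ε x : ℂ} {m : Fin 4 → ℂ} (h1 : m 1 = 1 / 2 - γ) (h2 : m 2 = 1 / 2 - δ)
    (h3 : m 3 = 1 / 2 - ε) (x0 : x ≠ 0) (x1 : x - 1 ≠ 0) (x2 : x - a ≠ 0) :
    4 * x * (x - 1) * (x - a) * (2 * factorLogDeriv m a x - heunP γ δ ε a x) +
      2 * ((x - 1) * (x - a) + x * (x - a) + x * (x - 1)) = 0 := by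
  rw [factorLogDeriv, heunP, h1, h2, h3]
  field_simp
  ring

/-- The coefficient of y in the transformed equation, divided by d. The Fuchs relation makes the
term linear in x equal to m₀ (m₀ + 1) x, through (α + β)² - 4 α β = (α - β)². -/
theorem heunQ_relation {α β γ δ ε x B : ℂ} {m : Fin 4 → ℂ} (h : γ + δ + ε = 1 + α + β)
    (hm : m = darbouxParam α β γ δ ε) (x0 : x ≠ 0) (x1 : x - 1 ≠ 0) (x2 : x - a ≠ 0) :
    4 * x * (x - 1) * (x - a) * (factorLogDeriv m a x ^ 2 +
        (m 1 / 2 / x ^ 2 + m 2 / 2 / (x - 1) ^ 2 + m 3 / 2 / (x - a) ^ 2) - heunQ α β a B x) +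
      2 * ((x - 1) * (x - a) + x * (x - a) + x * (x - 1)) * factorLogDeriv m a x =
    m 0 * (m 0 + 1) * x + m 1 * (m 1 + 1) * (a / x) + m 2 * (m 2 + 1) * ((1 - a) / (x - 1)) +
      m 3 * (m 3 + 1) * (a * (a - 1) / (x - a)) +
      (B - a * ((m 1 + m 2) ^ 2 - m 3 * (m 3 + 1)) - ((m 1 + m 3) ^ 2 - m 2 * (m 2 + 1))) := by
  obtain rfl : ε = 1 + α + β - γ - δ := by linear_combination h
  have h0 : m 0 = α - β - 1 / 2 := by rw [hm]; rfl
  have h1 : m 1 = 1 / 2 - γ := by rw [hm]; rfl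
  have h2 : m 2 = 1 / 2 - δ := by rw [hm]; rfl
  have h3 : m 3 = 1 / 2 - (1 + α + β - γ - δ) := by rw [hm]; rfl
  rw [factorLogDeriv, heunQ, h0, h1, h2, h3]
  field_simp
  ring

/-- The substitution takes solutions of the Heun equation to solutions of the Darboux equation;
the factor `g` enters only through its logarithmic derivative. -/
theorem isSolutionAt_darboux {α β γ δ ε B : ℂ} (hFuchs : γ + δ + ε = 1 + α + β)
    (hL : DistinctHalfValues L)
    (ha : a = (halfValue L 3 - halfValue L 1) / (halfValue L 2 - halfValue L 1))
    {m : Fin 4 → ℂ} (hm : m = darbouxParam α β γ δ ε) {z₀ : ℂ} (hz₀ : z₀ ∈ darbouxDomain L)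
    {y g : ℂ → ℂ} (hy : IsSolutionAt (heunP γ δ ε a) (heunQ α β a B) y (heunVar L z₀))
    (hg : AnalyticAt ℂ g z₀)
    (hg' : ∀ᶠ z in 𝓝 z₀, deriv g z = factorLogDeriv m a (heunVar L z) * heunVarDeriv L z * g z) :
    IsSolutionAt 0 (darbouxQ L m (darbouxB L m a B)) (fun z => g z * y (heunVar L z)) z₀ := by
  have hcont : ContinuousAt (heunVar L) z₀ := (analyticAt_heunVar hz₀).continuousAt
  have hloc : ∀ᶠ z in 𝓝 z₀, z ∈ darbouxDomain L ∧ AnalyticAt ℂ g z ∧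
      (deriv g z = factorLogDeriv m a (heunVar L z) * heunVarDeriv L z * g z) ∧
      IsSolutionAt (heunP γ δ ε a) (heunQ α β a B) y (heunVar L z) := by
    filter_upwards [isOpen_darbouxDomain.mem_nhds hz₀, hg.eventually_analyticAt, hg',
      hcont.eventually hy.eventually] with z h1 h2 h3 h4
    exact ⟨h1, h2, h3, h4⟩
  refine ⟨hg.mul (hy.1.comp (analyticAt_heunVar hz₀)), ?_⟩
  have hd1 : ∀ᶠ z in 𝓝 z₀, deriv (fun z => g z * y (heunVar L z)) z =
      g z * heunVarDeriv L z * (factorLogDeriv m a (heunVar L z) * y (heunVar L z) +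
        deriv y (heunVar L z)) := by
    filter_upwards [hloc] with z ⟨hz, h1, h2, h3⟩
    have e1 := h1.differentiableAt.hasDerivAt
    rw [h2] at e1
    have e2 := h3.1.differentiableAt.hasDerivAt.comp z (hasDerivAt_heunVar hz)
    have e3 := e1.fun_mul e2
    simp only [Function.comp_apply] at e3
    rw [e3.deriv]
    ring
  filter_upwards [hloc, hd1.eventually_nhds] with z ⟨hz, h1, h2, h3⟩ h4
  obtain ⟨x0, x1, x2⟩ := heunVar_ne hL ha hz
  have eg := h1.differentiableAt.hasDerivAt
  rw [h2] at eg
  have ex := hasDerivAt_heunVar hz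
  have ey := h3.1.differentiableAt.hasDerivAt.comp z ex
  have ey' := h3.1.deriv.differentiableAt.hasDerivAt.comp z ex
  have ek := (hasDerivAt_factorLogDeriv m x0 x1 x2).comp z ex
  have ex' := hasDerivAt_heunVarDeriv hL ha hz
  have hsum := (eg.fun_mul ex').fun_mul ((ek.fun_mul ey).fun_add ey')
  simp only [Function.comp_apply] at hsum
  rw [h4.self_of_nhds, EventuallyEq.deriv_eq h4, hsum.deriv, darbouxQ_eq hL ha hz]
  simp only [Pi.zero_apply, zero_mul, add_zero]
  have hs := heunVarDeriv_sq hL ha hz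
  have hode := h3.2.self_of_nhds
  have r1 := heunP_relation (m := m) (γ := γ) (δ := δ) (ε := ε) (by rw [hm]; rfl) (by rw [hm]; rfl)
    (by rw [hm]; rfl) x0 x1 x2
  have r2 := heunQ_relation (B := B) hFuchs hm x0 x1 x2
  generalize heunVarDeriv L z = X' at *
  generalize heunVar L z = x at *
  generalize halfValue L 2 - halfValue L 1 = d at *
  generalize factorLogDeriv m a x = k at *
  generalize deriv (deriv y) x = y2 at *
  -- The Heun equation eliminates y'', `r1` and `r2` settle the coefficients of y' and y, and the
  -- `hs` term replaces X'² by its polynomial in x.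
  linear_combination (g z * X' ^ 2) * hode + (g z * d * deriv y x) * r1 + (g z * d * y x) * r2 +
    g z * (k ^ 2 * y x + 2 * k * deriv y x +
      (m 1 / 2 / x ^ 2 + m 2 / 2 / (x - 1) ^ 2 + m 3 / 2 / (x - a) ^ 2) * y x -
      heunP γ δ ε a x * deriv y x - heunQ α β a B x * y x) * hs

/-- The branches of the factor have the expected logarithmic derivative. -/
theorem IsFactorBranch.logDeriv {m : Fin 4 → ℂ} {z₀ : ℂ} (hz₀ : z₀ ∈ darbouxDomain L) {g : ℂ → ℂ}
    (hg : IsFactorBranch L m a z₀ g) : AnalyticAt ℂ g z₀ ∧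
      ∀ᶠ z in 𝓝 z₀, deriv g z = factorLogDeriv m a (heunVar L z) * heunVarDeriv L z * g z := by
  obtain ⟨ℓ, hℓ, h⟩ := hg
  have hform : g =ᶠ[𝓝 z₀] fun z => Complex.exp (-m 1 / 2 * ℓ 0 z) * Complex.exp (-m 2 / 2 * ℓ 1 z)
      * Complex.exp (-m 3 / 2 * ℓ 2 z) := h.mono fun z hz => hz.2.2.2
  have hexp : ∀ (c : ℂ) (i : Fin 3), AnalyticAt ℂ (fun z => Complex.exp (c * ℓ i z)) z₀ :=
    fun c i => (analyticAt_const.mul (hℓ i)).cexp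
  refine ⟨(((hexp _ 0).mul (hexp _ 1)).mul (hexp _ 2)).congr hform.symm, ?_⟩
  filter_upwards [h.eventually_nhds, eventually_eventuallyEq_nhds.2 hform, (hℓ 0).eventually_analyticAt,
    (hℓ 1).eventually_analyticAt, (hℓ 2).eventually_analyticAt, isOpen_darbouxDomain.mem_nhds hz₀]
    with z h1 h2 a0 a1 a2 hz
  have hlog : ∀ (i : Fin 3) (c : ℂ), AnalyticAt ℂ (ℓ i) z →
      (∀ᶠ w in 𝓝 z, Complex.exp (ℓ i w) = heunVar L w - c) →
      deriv (ℓ i) z = heunVarDeriv L z / (heunVar L z - c) := fun i c hi he => by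
    have e1 := hi.differentiableAt.hasDerivAt.cexp
    have e2 := ((hasDerivAt_heunVar hz).sub_const c).congr_of_eventuallyEq he
    have := e1.unique e2
    rw [he.self_of_nhds] at this
    rw [← this, mul_div_cancel_left₀ _ (he.self_of_nhds ▸ Complex.exp_ne_zero _)]
  have d0 := hlog 0 0 a0 (h1.mono fun w hw => by rw [sub_zero]; exact hw.1)
  have d1 := hlog 1 1 a1 (h1.mono fun w hw => hw.2.1)
  have d2 := hlog 2 a a2 (h1.mono fun w hw => hw.2.2.1)
  have e := (((a0.differentiableAt.hasDerivAt.const_mul (-m 1 / 2)).cexp.fun_mul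
    (a1.differentiableAt.hasDerivAt.const_mul (-m 2 / 2)).cexp).fun_mul
    (a2.differentiableAt.hasDerivAt.const_mul (-m 3 / 2)).cexp)
  rw [h2.deriv_eq, e.deriv, h2.eq_of_nhds, d0, d1, d2, factorLogDeriv, sub_zero]
  ring

end Transform

/-! ### Scalar factors -/

section Factor

/-- `g` is a solution of `g' = k g` near `z`. -/
def IsFactorAt (k g : ℂ → ℂ) (z : ℂ) : Prop :=
  AnalyticAt ℂ g z ∧ ∀ᶠ w in 𝓝 z, deriv g w = k w * g w

/-- Near a regular point of `k`, the solutions of `g' = k g` are the multiples of a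
nowhere vanishing one. -/
theorem exists_factor {k : ℂ → ℂ} {z : ℂ} (hk : AnalyticAt ℂ k z) :
    ∃ U ∈ 𝓝 z, ∃ E : ℂ → ℂ, (∀ w ∈ U, IsFactorAt k E w) ∧ (∀ w, E w ≠ 0) ∧
      ∀ w ∈ U, ∀ g, IsFactorAt k g w → ∃ c : ℂ, g =ᶠ[𝓝 w] fun x => c * E x := by
  obtain ⟨r, hr, hB⟩ := Metric.eventually_nhds_iff_ball.1 hk.eventually_analyticAt
  have hkd : DifferentiableOn ℂ k (Metric.ball z r) := fun x hx =>
    (hB x hx).differentiableAt.differentiableWithinAt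
  obtain ⟨P, hP⟩ := hkd.isExactOn_ball
  have hev : ∀ w ∈ Metric.ball z r, ∀ᶠ x in 𝓝 w, x ∈ Metric.ball z r := fun w hw =>
    Metric.isOpen_ball.mem_nhds hw
  have hPan : ∀ w ∈ Metric.ball z r, AnalyticAt ℂ P w := fun w hw =>
    DifferentiableOn.analyticAt
      (fun x hx => (hP x hx).differentiableAt.differentiableWithinAt) (hev w hw)
  refine ⟨Metric.ball z r, Metric.ball_mem_nhds _ hr, fun x => Complex.exp (P x),
    fun w hw => ⟨(hPan w hw).cexp, ?_⟩, fun w => Complex.exp_ne_zero _, fun w hw g hg => ?_⟩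
  · filter_upwards [hev w hw] with x hx
    rw [(hP x hx).cexp.deriv, mul_comm]
  · have hd : ∀ᶠ x in 𝓝 w, HasDerivAt (fun x => g x * Complex.exp (-P x)) 0 x := by
      filter_upwards [hev w hw, hg.1.eventually_analyticAt, hg.2] with x hx h1 h2
      refine (h1.differentiableAt.hasDerivAt.fun_mul (hP x hx).fun_neg.cexp).congr_deriv ?_
      rw [h2]
      ring
    refine ⟨g w * Complex.exp (-P w), ?_⟩
    filter_upwards [eventually_eq_of_hasDerivAt_zero hd] with x hx
    rw [← hx, mul_assoc, ← Complex.exp_add, neg_add_cancel, Complex.exp_zero, mul_one]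

theorem exists_factor_continues {k : ℂ → ℂ} {a b : ℂ} (γ : Path a b)
    (hk : ∀ t, AnalyticAt ℂ k (γ t)) {g : ℂ → ℂ} (hg : IsFactorAt k g a) :
    ∃ G, Continues (fun z g => IsFactorAt k g z) γ G ∧ G 0 = g := by
  refine exists_continues γ (fun t => ?_) hg
  obtain ⟨U, hU, E, hE, -, hE'⟩ := exists_factor (hk t)
  refine ⟨U, hU, fun w hw f hf => ?_⟩
  obtain ⟨c, hc⟩ := hE' w hw f hf
  refine ⟨fun x => c * E x, fun z hz => ⟨analyticAt_const.mul (hE z hz).1, ?_⟩, hc.symm⟩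
  filter_upwards [(hE z hz).1.eventually_analyticAt, (hE z hz).2] with x h1 h2
  rw [(h1.differentiableAt.hasDerivAt.const_mul c).deriv, h2]
  ring

end Factor

/-! ### Monodromy -/

section Monodromy

/-- The matrices preserving H form a group, so generators suffice; monodromy groups are given by
generators. -/
theorem isUnitary_closure {S : Set (GL (Fin 2) ℂ)} {H : Matrix (Fin 2) (Fin 2) ℂ}
    (hH : H.IsHermitian) (hdet : IsUnit H.det)
    (hS : ∀ g ∈ S, (g : Matrix (Fin 2) (Fin 2) ℂ)ᴴ * H * (g : Matrix (Fin 2) (Fin 2) ℂ) = H) :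
    IsUnitary (Subgroup.closure S) := by
  refine ⟨H, hH, hdet, fun g hg => ?_⟩
  induction hg using Subgroup.closure_induction with
  | mem g hg => exact hS g hg
  | one => simp
  | mul g h _ _ hg hh =>
    rw [Units.val_mul, Matrix.conjTranspose_mul]
    calc _ = (h : Matrix (Fin 2) (Fin 2) ℂ)ᴴ * ((g : Matrix (Fin 2) (Fin 2) ℂ)ᴴ * H * g) * h := by
          simp only [mul_assoc]
      _ = H := by rw [hg, hh]
  | inv g _ hg =>
    have h1 : (g : Matrix (Fin 2) (Fin 2) ℂ) * ((g⁻¹ : GL (Fin 2) ℂ) : Matrix _ _ ℂ) = 1 := by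
      rw [← Units.val_mul, mul_inv_cancel, Units.val_one]
    have h2 : ((g⁻¹ : GL (Fin 2) ℂ) : Matrix (Fin 2) (Fin 2) ℂ)ᴴ *
        (g : Matrix (Fin 2) (Fin 2) ℂ)ᴴ = 1 := by
      rw [← Matrix.conjTranspose_mul, h1, Matrix.conjTranspose_one]
    conv_lhs => rw [← hg]
    calc _ = (((g⁻¹ : GL (Fin 2) ℂ) : Matrix (Fin 2) (Fin 2) ℂ)ᴴ *
          (g : Matrix (Fin 2) (Fin 2) ℂ)ᴴ) * H *
          ((g : Matrix (Fin 2) (Fin 2) ℂ) * ((g⁻¹ : GL (Fin 2) ℂ) : Matrix _ _ ℂ)) := by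
          simp only [mul_assoc]
      _ = H := by rw [h1, h2, one_mul, mul_one]

/-- Monodromy matrices do not change when the base point and the solutions are moved along
a path. -/
theorem isMonodromyMatrix_of_loop {Ω : Set ℂ} {p q : ℂ → ℂ} {x₀ x₁ : ℂ} {s : Path x₀ x₁}
    (hs : ∀ t, s t ∈ Ω) {F : Fin 2 → I → ℂ → ℂ} (hF : ∀ i, IsContinuation p q s (F i))
    {τ : Path x₁ x₁} (hτ : ∀ t, τ t ∈ Ω) {K : Fin 2 → I → ℂ → ℂ}
    (hK : ∀ i, IsContinuation p q τ (K i)) (h0 : ∀ i, F i 1 =ᶠ[𝓝 x₁] K i 0)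
    {N : GL (Fin 2) ℂ} (h1 : ∀ i, ∀ᶠ w in 𝓝 x₁,
      K i 1 w = ∑ j, (N : Matrix (Fin 2) (Fin 2) ℂ) i j * F j 1 w) :
    IsMonodromyMatrix Ω ⊥ p q x₀ (fun i => F i 0) N := by
  -- Along the way back, the result of τ is a constant combination of the F j, so reversing their
  -- continuations yields the same matrix N at x₀.
  have hback : ∀ i, IsContinuation p q s.symm
      (fun t w => ∑ j, (N : Matrix (Fin 2) (Fin 2) ℂ) i j * F j (σ t) w) := fun i =>
    IsContinuation.sum (F := fun j t => F j (σ t))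
      (fun j => isContinuation_iff.2 (isContinuation_iff.1 (hF j)).symm) _
  choose A hA hA0 hA1 using fun i =>
    (isContinuation_iff.1 (hF i)).trans (isContinuation_iff.1 (hK i)) (h0 i)
  choose C hC hC0 hC1 using fun i =>
    (hA i).trans (isContinuation_iff.1 (hback i)) (by
      filter_upwards [h1 i] with w hw
      rw [hA1, hw, unitInterval.symm_zero])
  -- The only translation is 0, and the cast replaces the endpoint x₀ by x₀ + 0.
  refine ⟨0, rfl, ((s.trans τ).trans s.symm).cast rfl (add_zero _), fun t => ?_, C, fun i => ?_,
    fun i => ?_, fun i => ?_⟩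
  · have hmem : ((s.trans τ).trans s.symm) t ∈ Set.range ((s.trans τ).trans s.symm) :=
      Set.mem_range_self t
    rw [Path.trans_range, Path.trans_range, Path.symm_range] at hmem
    rcases hmem with (⟨r, hr⟩ | ⟨r, hr⟩) | ⟨r, hr⟩
    · exact (hr ▸ hs r :)
    · exact (hr ▸ hτ r :)
    · exact (hr ▸ hs r :)
  · exact ⟨(hC i).sol, (hC i).compat⟩
  · rw [hC0, hA0]
  · refine .of_forall fun w => ?_
    rw [hC1, add_zero, unitInterval.symm_one]

theorem star_det_mul_det_of_preserves {H N : Matrix (Fin 2) (Fin 2) ℂ} (hH : IsUnit H.det)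
    (h : Nᴴ * H * N = H) : star N.det * N.det = 1 := by
  have h1 := congrArg Matrix.det h
  rw [Matrix.det_mul, Matrix.det_mul, Matrix.det_conjTranspose] at h1
  refine mul_right_cancel₀ hH.ne_zero ?_
  linear_combination h1

/-- A matrix of determinant `1` that is conjugate to a multiple of a matrix which preserves the
form `H` preserves the transformed form. -/
theorem preserves_of_conj_smul {H N M A : Matrix (Fin 2) (Fin 2) ℂ} {c : ℂ} (hH : IsUnit H.det)
    (hN : Nᴴ * H * N = H) (hA : A.det ≠ 0) (hM : M.det = 1) (h : A * M = c • (N * A)) :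
    Mᴴ * (Aᴴ * H * A) * M = Aᴴ * H * A := by
  have hdet := congrArg Matrix.det h
  rw [Matrix.det_mul, Matrix.det_smul, Matrix.det_mul, hM, Fintype.card_fin] at hdet
  have h1 : c ^ 2 * N.det = 1 := by
    refine mul_right_cancel₀ hA ?_
    linear_combination -hdet
  -- Taking absolute values in c² det N = 1, with |det N| = 1 because N preserves H.
  have hc : star c * c = 1 := by
    have h2 := congrArg norm h1
    have h3 := congrArg norm (star_det_mul_det_of_preserves hH hN)
    rw [norm_mul, norm_star, norm_one] at h3
    rw [norm_mul, norm_pow, norm_one] at h2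
    have h4 : ‖N.det‖ = 1 := by nlinarith [norm_nonneg N.det]
    have h5 : ‖c‖ ^ 2 = 1 := by rw [h4, mul_one] at h2; exact h2
    rw [Complex.star_def, Complex.conj_mul', ← Complex.ofReal_pow, h5, Complex.ofReal_one]
  calc Mᴴ * (Aᴴ * H * A) * M = (A * M)ᴴ * H * (A * M) := by
        rw [Matrix.conjTranspose_mul]; simp only [mul_assoc]
    _ = (star c * c) • (Aᴴ * (Nᴴ * H * N) * A) := by
        rw [h, Matrix.conjTranspose_smul, Matrix.conjTranspose_mul]
        simp only [smul_mul_assoc, mul_smul_comm, smul_smul, mul_assoc, mul_comm]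
    _ = Aᴴ * H * A := by rw [hc, hN, one_smul]

/-- Without a term of the first order, monodromy matrices have determinant `1`. -/
theorem IsMonodromyMatrix.det_eq_one {Ω : Set ℂ} {Λ : AddSubgroup ℂ} {q : ℂ → ℂ} {z₀ : ℂ}
    {u : Fin 2 → ℂ → ℂ} {M : GL (Fin 2) ℂ} (hq : AnalyticAt ℂ q z₀)
    (hu : IsFundamentalAt 0 q u z₀) (hM : IsMonodromyMatrix Ω Λ 0 q z₀ u M) :
    (M : Matrix (Fin 2) (Fin 2) ℂ).det = 1 := by
  obtain ⟨l, -, γ, -, F, hF, hF0, hF1⟩ := hM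
  have h1 := wronskian_continuation hF 1 0
  have h2 := wronskian_comb (fun i => (hu.sol i).1) hF1
  have h3 : wronskian (fun i w => F i 1 (w + l)) z₀ = wronskian (fun i => F i 1) (γ 1) := by
    simp only [wronskian, deriv_comp_add_const, γ.target]
  have h4 : wronskian (fun i => F i 0) (γ 0) = wronskian u z₀ := by
    simp only [wronskian, γ.source, (hF0 _).deriv_eq, (hF0 _).eq_of_nhds]
  have hW := hu.wronskian_ne_zero analyticAt_const hq
  refine mul_right_cancel₀ hW ?_
  rw [← h2, h3, h1, h4, one_mul]

end Monodromy

/-! ### The monodromy of the Darboux equation -/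

section Main

variable {L : PeriodPair} {a : ℂ}

theorem analyticAt_heunP {γ δ ε x : ℂ} (x0 : x ≠ 0) (x1 : x - 1 ≠ 0) (x2 : x - a ≠ 0) :
    AnalyticAt ℂ (heunP γ δ ε a) x :=
  ((analyticAt_const.div analyticAt_id x0).add
    (analyticAt_const.div (analyticAt_id.sub analyticAt_const) x1)).add
    (analyticAt_const.div (analyticAt_id.sub analyticAt_const) x2)

theorem analyticAt_heunQ {α β B x : ℂ} (x0 : x ≠ 0) (x1 : x - 1 ≠ 0) (x2 : x - a ≠ 0) :
    AnalyticAt ℂ (heunQ α β a B) x :=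
  ((analyticAt_const.mul analyticAt_id).sub analyticAt_const).div
    ((analyticAt_id.mul (analyticAt_id.sub analyticAt_const)).mul
      (analyticAt_id.sub analyticAt_const)) (mul_ne_zero (mul_ne_zero x0 x1) x2)

theorem analyticAt_factorLogDeriv {m : Fin 4 → ℂ} {x : ℂ} (x0 : x ≠ 0) (x1 : x - 1 ≠ 0)
    (x2 : x - a ≠ 0) : AnalyticAt ℂ (factorLogDeriv m a) x :=
  ((analyticAt_const.div analyticAt_id x0).sub
    (analyticAt_const.div (analyticAt_id.sub analyticAt_const) x1)).sub
    (analyticAt_const.div (analyticAt_id.sub analyticAt_const) x2)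

theorem analyticAt_darbouxQ {m : Fin 4 → ℂ} {B' z : ℂ} (hz : z ∈ darbouxDomain L) :
    AnalyticAt ℂ (darbouxQ L m B') z := by
  have h : ∀ i, AnalyticAt ℂ (fun z => m i * (m i + 1) * L.weierstrassP (z - halfPeriod L i)) z :=
    fun i => analyticAt_const.mul <| (L.analyticOnNhd_weierstrassP _
      (sub_half_notMem_lattice (two_mul_halfPeriod_mem i) hz)).comp_of_eq
        (f := fun z => z - halfPeriod L i) (by fun_prop) rfl
  exact (Finset.analyticAt_fun_sum _ fun i _ => h i).neg.sub analyticAt_const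

theorem isPathConnected_heunDomain : IsPathConnected {x : ℂ | x ≠ 0 ∧ x ≠ 1 ∧ x ≠ a} := by
  have h := Set.Countable.isPathConnected_compl_of_one_lt_rank (E := ℂ)
    (by rw [Complex.rank_real_complex]; norm_num) (Set.toFinite ({0, 1, a} : Set ℂ)).countable
  convert h using 1
  ext x
  simp

theorem IsFactorAt.comp_heunVar {m : Fin 4 → ℂ} {g : ℂ → ℂ} {z : ℂ} (hz : z ∈ darbouxDomain L)
    (hg : IsFactorAt (factorLogDeriv m a) g (heunVar L z)) :
    AnalyticAt ℂ (fun w => g (heunVar L w)) z ∧ ∀ᶠ w in 𝓝 z, deriv (fun w => g (heunVar L w)) w =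
      factorLogDeriv m a (heunVar L w) * heunVarDeriv L w * g (heunVar L w) := by
  refine ⟨hg.1.comp (analyticAt_heunVar hz), ?_⟩
  have hc := (analyticAt_heunVar hz).continuousAt
  filter_upwards [isOpen_darbouxDomain.mem_nhds hz, hc.eventually hg.2,
    hc.eventually hg.1.eventually_analyticAt] with w h1 h2 h3
  have e := h3.differentiableAt.hasDerivAt.comp w (hasDerivAt_heunVar h1)
  rw [Function.comp_def] at e
  rw [e.deriv, h2]
  ring

/-- A relation between functions of `heunVar L z` near `z₀` is a relation between functions
of `x`. -/
theorem eventually_of_heunVar (hL : DistinctHalfValues L) {z₀ : ℂ} (hz₀ : z₀ ∈ darbouxDomain L)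
    {P : ℂ → Prop} (h : ∀ᶠ z in 𝓝 z₀, P (heunVar L z)) : ∀ᶠ x in 𝓝 (heunVar L z₀), P x := by
  have hs : HasStrictDerivAt (heunVar L) (heunVarDeriv L z₀) z₀ := by
    have := (analyticAt_heunVar hz₀).hasStrictDerivAt
    rwa [(hasDerivAt_heunVar hz₀).deriv] at this
  -- A non-zero derivative makes `heunVar L` open at z₀, so it carries the neighbourhood filter onto
  -- that of its value.
  rw [← hs.map_nhds_eq (heunVarDeriv_ne_zero hL hz₀)]
  exact h

/-- The pullback to the `z`-plane of a fundamental system of the Heun equation. -/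
theorem isFundamentalAt_pullback {α β γ δ ε B : ℂ} (hFuchs : γ + δ + ε = 1 + α + β)
    (hL : DistinctHalfValues L)
    (ha : a = (halfValue L 3 - halfValue L 1) / (halfValue L 2 - halfValue L 1))
    {m : Fin 4 → ℂ} (hm : m = darbouxParam α β γ δ ε) {z₀ : ℂ} (hz₀ : z₀ ∈ darbouxDomain L)
    {y : Fin 2 → ℂ → ℂ} {E : ℂ → ℂ}
    (hy : IsFundamentalAt (heunP γ δ ε a) (heunQ α β a B) y (heunVar L z₀))
    (hE : IsFactorAt (factorLogDeriv m a) E (heunVar L z₀)) (hE0 : ∀ x, E x ≠ 0) :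
    IsFundamentalAt 0 (darbouxQ L m (darbouxB L m a B))
      (fun i z => E (heunVar L z) * y i (heunVar L z)) z₀ := by
  obtain ⟨g1, g2⟩ := hE.comp_heunVar hz₀
  refine ⟨fun i => isSolutionAt_darboux hFuchs hL ha hm hz₀ (hy.sol i) g1 g2, fun c hc => ?_⟩
  refine hy.indep c (eventually_of_heunVar hL hz₀ ?_)
  filter_upwards [hc] with z hz
  refine (mul_eq_zero.1 (?_ : E (heunVar L z) * _ = 0)).resolve_left (hE0 _)
  rw [← hz, Finset.mul_sum]
  exact Finset.sum_congr rfl fun i _ => by ring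

/-- Up to a scalar and the choice of the basis, a monodromy matrix of the Darboux equation is a
monodromy matrix of the Heun equation. -/
theorem exists_heun_loop {α β γ δ ε B : ℂ} (hFuchs : γ + δ + ε = 1 + α + β)
    (hL : DistinctHalfValues L)
    (ha : a = (halfValue L 3 - halfValue L 1) / (halfValue L 2 - halfValue L 1))
    {m : Fin 4 → ℂ} (hm : m = darbouxParam α β γ δ ε) {z₀ : ℂ} (hz₀ : z₀ ∈ darbouxDomain L)
    {y u : Fin 2 → ℂ → ℂ} {E : ℂ → ℂ}
    (hy : IsFundamentalAt (heunP γ δ ε a) (heunQ α β a B) y (heunVar L z₀))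
    (hE : IsFactorAt (factorLogDeriv m a) E (heunVar L z₀))
    (hE' : ∀ g, IsFactorAt (factorLogDeriv m a) g (heunVar L z₀) →
      ∃ c : ℂ, g =ᶠ[𝓝 (heunVar L z₀)] fun x => c * E x)
    (hu : IsFundamentalAt 0 (darbouxQ L m (darbouxB L m a B)) u z₀)
    {A : Matrix (Fin 2) (Fin 2) ℂ}
    (hA : ∀ i, ∀ᶠ z in 𝓝 z₀, E (heunVar L z) * y i (heunVar L z) = ∑ j, A i j * u j z)
    {M : GL (Fin 2) ℂ} (hM : IsMonodromyMatrix (darbouxDomain L) L.lattice.toAddSubgroup 0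
      (darbouxQ L m (darbouxB L m a B)) z₀ u M) :
    ∃ (c : ℂ) (N : Matrix (Fin 2) (Fin 2) ℂ),
      A * (M : Matrix (Fin 2) (Fin 2) ℂ) = c • (N * A) ∧
      ∃ τ : Path (heunVar L z₀) (heunVar L z₀), (∀ t, τ t ∈ {x | x ≠ 0 ∧ x ≠ 1 ∧ x ≠ a}) ∧
        ∃ Y : Fin 2 → I → ℂ → ℂ,
          (∀ i, IsContinuation (heunP γ δ ε a) (heunQ α β a B) τ (Y i)) ∧
          (∀ i, Y i 0 = y i) ∧
          ∀ i, ∀ᶠ w in 𝓝 (heunVar L z₀), Y i 1 w = ∑ j, N i j * y j w := by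
  obtain ⟨l, hl, κ, hκ, F, hF, hF0, hF1⟩ := hM
  have hl' : l ∈ L.lattice := hl
  have hcont : ContinuousOn (heunVar L) (Set.range κ) := by
    rintro _ ⟨t, rfl⟩
    exact (analyticAt_heunVar (hκ t)).continuousAt.continuousWithinAt
  -- The image path closes up because `heunVar L` has period l.
  let τ : Path (heunVar L z₀) (heunVar L z₀) := (κ.map' hcont).cast rfl (heunVar_add z₀ hl').symm
  have hτ : ∀ t, τ t = heunVar L (κ t) := fun t => rfl
  have hne : ∀ t, τ t ≠ 0 ∧ τ t - 1 ≠ 0 ∧ τ t - a ≠ 0 := fun t => heunVar_ne hL ha (hκ t)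
  have hp : ∀ t, AnalyticAt ℂ (heunP γ δ ε a) (τ t) := fun t =>
    analyticAt_heunP (hne t).1 (hne t).2.1 (hne t).2.2
  have hq : ∀ t, AnalyticAt ℂ (heunQ α β a B) (τ t) := fun t =>
    analyticAt_heunQ (hne t).1 (hne t).2.1 (hne t).2.2
  choose Y hY hY0 using fun i => exists_isContinuation hp hq (hy.sol i)
  obtain ⟨G, hG, hG0⟩ := exists_factor_continues τ
    (fun t => analyticAt_factorLogDeriv (hne t).1 (hne t).2.1 (hne t).2.2) hE
  -- c is the multiplier of the scalar factor around τ.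
  obtain ⟨c, hc⟩ := hE' (G 1) (by simpa only [τ.target] using hG.sol 1)
  have hp1 := hp 1
  have hq1 := hq 1
  rw [τ.target] at hp1 hq1
  obtain ⟨N, hN⟩ := hy.exists_matrix hp1 hq1 (v := fun i => Y i 1) fun i => by
    simpa only [τ.target] using (hY i).sol 1
  have hV : ∀ i, IsContinuation 0 (darbouxQ L m (darbouxB L m a B)) κ
      (fun t z => G t (heunVar L z) * Y i t (heunVar L z)) := fun i => by
    refine ⟨fun t => ?_, fun t => ?_⟩
    · obtain ⟨g1, g2⟩ := IsFactorAt.comp_heunVar (hκ t) (hG.sol t)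
      exact isSolutionAt_darboux hFuchs hL ha hm (hκ t) ((hY i).sol t) g1 g2
    · filter_upwards [hG.compat t, (hY i).compat t] with s h1 h2
      filter_upwards [(analyticAt_heunVar (hκ s)).continuousAt.eventually h1,
        (analyticAt_heunVar (hκ s)).continuousAt.eventually h2] with z e1 e2
      rw [e1, e2]
  -- Both sides continue the same germ along κ. Shifting by l and comparing coefficients in the
  -- basis u then yields A M = c N A.
  have hend : ∀ i, ∀ᶠ z in 𝓝 (z₀ + l),
      G 1 (heunVar L z) * Y i 1 (heunVar L z) = ∑ j, A i j * F j 1 z := fun i => by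
    have := (hV i).eventuallyEq (IsContinuation.sum hF (A i)) (t₀ := 0) (by
      rw [κ.source, hG0, hY0]
      filter_upwards [hA i, hF0 0, hF0 1] with z e e0 e1
      simp only [e, Fin.sum_univ_two, e0, e1]) 1
    rwa [κ.target] at this
  refine ⟨c, N, hu.matrix_ext fun i => ?_, τ, fun t => ⟨(hne t).1, sub_ne_zero.1 (hne t).2.1,
    sub_ne_zero.1 (hne t).2.2⟩, Y, hY, hY0, hN⟩
  have hshift : Tendsto (fun w : ℂ => w + l) (𝓝 z₀) (𝓝 (z₀ + l)) :=
    (continuous_add_const l).tendsto z₀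
  have hx := (analyticAt_heunVar hz₀).continuousAt
  filter_upwards [hshift.eventually (hend i), hF1 0, hF1 1, hA 0, hA 1, hx.eventually hc,
    hx.eventually (hN i)] with w h1 f0 f1 a0 a1 hcw hNw
  rw [heunVar_add w hl', hcw, hNw] at h1
  simp only [Fin.sum_univ_two, f0, f1] at h1 a0 a1
  simp only [Matrix.mul_apply, Matrix.smul_apply, Fin.sum_univ_two, smul_eq_mul]
  linear_combination -h1 + c * N i 0 * a0 + c * N i 1 * a1

/-- The invariant form is Aᴴ H A, where A expresses the pulled-back Heun basis by u. It is
independent of the loop and non-degenerate because A is invertible. -/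
theorem isUnitary_darbouxGroup {α β γ δ ε B : ℂ} (hFuchs : γ + δ + ε = 1 + α + β)
    (hL : DistinctHalfValues L)
    (ha : a = (halfValue L 3 - halfValue L 1) / (halfValue L 2 - halfValue L 1))
    {m : Fin 4 → ℂ} (hm : m = darbouxParam α β γ δ ε) {x₀ : ℂ} {y : Fin 2 → ℂ → ℂ}
    (hx₀ : x₀ ∈ {x | x ≠ 0 ∧ x ≠ 1 ∧ x ≠ a})
    (hy : IsFundamentalAt (heunP γ δ ε a) (heunQ α β a B) y x₀)
    (hunit : IsUnitary (heunGroup α β γ δ ε a B x₀ y)) {z₀ : ℂ} {u : Fin 2 → ℂ → ℂ}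
    (hz₀ : z₀ ∈ darbouxDomain L)
    (hu : IsFundamentalAt 0 (darbouxQ L m (darbouxB L m a B)) u z₀) :
    IsUnitary (darbouxGroup L m (darbouxB L m a B) z₀ u) := by
  obtain ⟨H, hH, hHdet, hHG⟩ := hunit
  obtain ⟨n0, n1, n2⟩ := heunVar_ne hL ha hz₀
  -- The Heun basis is moved from x₀ to the image of z₀. A loop τ there has the monodromy matrix of
  -- s τ s⁻¹ at x₀, so the same H applies.
  obtain ⟨s, hs⟩ := isPathConnected_heunDomain.joinedIn x₀ hx₀ (heunVar L z₀)
    ⟨n0, sub_ne_zero.1 n1, sub_ne_zero.1 n2⟩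
  choose K hK hK0 using fun i => exists_isContinuation (γ := s)
    (fun t => analyticAt_heunP (γ := γ) (δ := δ) (ε := ε) (hs t).1 (sub_ne_zero.2 (hs t).2.1)
      (sub_ne_zero.2 (hs t).2.2))
    (fun t => analyticAt_heunQ (α := α) (β := β) (B := B) (hs t).1 (sub_ne_zero.2 (hs t).2.1)
      (sub_ne_zero.2 (hs t).2.2)) (hy.sol i)
  have hy₁ := IsContinuation.isFundamentalAt hK (t₀ := 0) (by simpa only [s.source, hK0] using hy) 1
  rw [s.target] at hy₁
  obtain ⟨U, hU, E, hE, hE0, hE'⟩ := exists_factor (analyticAt_factorLogDeriv (m := m) n0 n1 n2)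
  have hEx := hE _ (mem_of_mem_nhds hU)
  have hv := isFundamentalAt_pullback hFuchs hL ha hm hz₀ hy₁ hEx hE0
  obtain ⟨A, hA⟩ := hu.exists_matrix analyticAt_const (analyticAt_darbouxQ hz₀) hv.sol
  have hAdet := hv.isUnit_det hA
  refine isUnitary_closure (Matrix.isHermitian_conjTranspose_mul_mul A hH) ?_ fun M hM => ?_
  · rw [Matrix.det_mul, Matrix.det_mul, Matrix.det_conjTranspose]
    exact ((isUnit_iff_ne_zero.2 (star_ne_zero.2 hAdet)).mul hHdet).mul
      (isUnit_iff_ne_zero.2 hAdet)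
  · have hdet := IsMonodromyMatrix.det_eq_one (analyticAt_darbouxQ hz₀) hu hM
    obtain ⟨c, N, hAM, τ, hτ, Y, hY, hY0, hY1⟩ := exists_heun_loop hFuchs hL ha hm hz₀ hy₁ hEx
      (hE' _ (mem_of_mem_nhds hU)) hu hA hM
    have hNdet : N.det ≠ 0 := by
      intro h0
      have := congrArg Matrix.det hAM
      rw [Matrix.det_mul, Matrix.det_smul, Matrix.det_mul, hdet, h0, zero_mul, mul_zero,
        mul_one] at this
      exact hAdet this
    have hmem : IsMonodromyMatrix {x | x ≠ 0 ∧ x ≠ 1 ∧ x ≠ a} ⊥ (heunP γ δ ε a) (heunQ α β a B) x₀ y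
        (Matrix.GeneralLinearGroup.mkOfDetNeZero N hNdet) := by
      have := isMonodromyMatrix_of_loop hs hK hτ hY (fun i => by rw [hY0])
        (N := Matrix.GeneralLinearGroup.mkOfDetNeZero N hNdet) hY1
      simpa only [hK0] using this
    exact preserves_of_conj_smul hHdet (hHG _ (Subgroup.subset_closure hmem)) hAdet hdet hAM

end Main

end HeunDarboux

/-! ### The transformation of solutions and the transfer of unitarity -/

theorem corollary3 (α β γ δ ε a B : ℂ)
    (hFuchs : γ + δ + ε = 1 + α + β) (ha₀ : a ≠ 0) (ha₁ : a ≠ 1)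
    (L : PeriodPair)
    (ha : a = (HeunDarboux.halfValue L 3 - HeunDarboux.halfValue L 1) /
      (HeunDarboux.halfValue L 2 - HeunDarboux.halfValue L 1))
    (m : Fin 4 → ℂ) (hm : m = HeunDarboux.darbouxParam α β γ δ ε)
    (B' : ℂ) (hB' : B' = HeunDarboux.darbouxB L m a B) :
    -- the Darboux equation with these parameters is the transform of the Heun equation
    (∀ z₀ ∈ HeunDarboux.darbouxDomain L, ∀ y g : ℂ → ℂ,
      HeunDarboux.IsSolutionAt (HeunDarboux.heunP γ δ ε a) (HeunDarboux.heunQ α β a B) y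
        (HeunDarboux.heunVar L z₀) →
      HeunDarboux.IsFactorBranch L m a z₀ g →
      HeunDarboux.IsSolutionAt 0 (HeunDarboux.darbouxQ L m B')
        (fun z => g z * y (HeunDarboux.heunVar L z)) z₀) ∧
    -- unitarity passes from the Heun equation to the Darboux equation
    (∀ (x₀ : ℂ) (y : Fin 2 → ℂ → ℂ), x₀ ≠ 0 → x₀ ≠ 1 → x₀ ≠ a →
      HeunDarboux.IsFundamentalAt (HeunDarboux.heunP γ δ ε a) (HeunDarboux.heunQ α β a B) y x₀ →
      HeunDarboux.IsUnitary (HeunDarboux.heunGroup α β γ δ ε a B x₀ y) →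
      (HeunDarboux.naturalRep (HeunDarboux.heunGroup α β γ δ ε a B x₀ y)).IsIrreducible →
      ∀ (z₀ : ℂ) (u : Fin 2 → ℂ → ℂ), z₀ ∈ HeunDarboux.darbouxDomain L →
        HeunDarboux.IsFundamentalAt 0 (HeunDarboux.darbouxQ L m B') u z₀ →
        HeunDarboux.IsUnitary (HeunDarboux.darbouxGroup L m B' z₀ u)) := by
  have hL := HeunDarboux.distinctHalfValues_of_param ha₀ ha₁ ha
  subst hB'
  refine ⟨fun z₀ hz₀ y g hy hg => ?_, fun x₀ y h0 h1 h2 hy hunit _ z₀ u hz₀ hu => ?_⟩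
  · obtain ⟨g1, g2⟩ := hg.logDeriv hz₀
    exact HeunDarboux.isSolutionAt_darboux hFuchs hL ha hm hz₀ hy g1 g2
  · exact HeunDarboux.isUnitary_darbouxGroup hFuchs hL ha hm ⟨h0, h1, h2⟩ hy hunit hz₀ hu
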